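/- **Setting.** A Gaussian fermion channel on a finite set of Majorana modes acts on correlation matrices ($\Gamma$ real, $\Gamma^T=-\Gamma$, $\Gamma\Gamma^T\le I$) by $\mathcal N[\Gamma]=A+B\Gamma B^T$, where $A$ is real antisymmetric, $B$ is real, and complete positivity and trace preservation hold in the form $\Lambda^T\Lambda\le I$ with $\Lambda=\begin{pmatrix}A&B\\-B^T&0\end{pmatrix}$. A translationally invariant 1D local Gaussian fermion channel with $m$ Majorana modes per unit cell is given by two finitely supported kernels $a,b:\mathbb Z\to\mathbb R^{m\times m}$ such that for every $L\ge1$ the matrices $$A^{(L)}_{(x,\alpha),(y,\beta)}=\sum_{r\equiv x-y\ (L)}a(r)_{\alpha\beta},\qquad B^{(L)}_{(x,\alpha),(y,\beta)}=\sum_{r\equiv x-y\ (L)}b(r)_{\alpha\beta}$$ define a Gaussian fermion channel on the periodic ring $\mathbb Z/L$ of $L$ unit cells. Its momentum-space matrices are $A_k=\sum_r e^{-ikr}a(r)$ and $B_k=\sum_r e^{-ikr}b(r)$, $k\in\mathbb R$, acting by $\Gamma\mapsto A_k+B_k\Gamma B_k^\dagger$ on complex matrices with $\Gamma^\dagger=-\Gamma$,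 $\Gamma\Gamma^\dagger\le I$. For a channel $(A,B)$, the preserved modes $V_u$ are the complex span of the eigenvectors of $B$ whose eigenvalues have modulus one, the dissipative modes are $V_d=V_u^\perp$, and $P_d$ is the orthogonal projector onto $V_d$. The steady-state correlation matrix between dissipative modes is the matrix $\Gamma_d^{(s)}$ with $\Gamma_d^{(s)}=P_d\,\mathcal N[\Gamma_d^{(s)}]\,P_d$ and $P_d\,\mathcal N^t[\Gamma_0]\,P_d\to\Gamma_d^{(s)}$ as $t\to\infty$ for every initial correlation matrix $\Gamma_0$ (it is unique if it exists). **Statement.** For every translationally invariant 1D local Gaussian fermion channel: 1. For every real $k$ the steady-state correlation matrix $\Gamma^{(s)}_{k,d}$ between the dissipative modes of $(A_k,B_k)$ exists. It is $2\pi$-periodic in $k$ and analytic up to removable singularities: there are $\delta>0$ and a $2\pi$-periodic matrix function, holomorphic on $\{|\operatorname{Im}z|<\delta\}$, that agrees with $\Gamma^{(s)}_{k,d}$ for all but finitely many $k\in[0,2\pi)$. 2. For every $L\ge1$ the steady-state correlation matrix $\Gamma^{(s),L}_d$ between the dissipative modes of the channel on the ring of $L$ unit cells exists. In the thermodynamic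 limit these correlations converge and decay exponentially in space: for all $x,y\in\mathbb Z$ and all $\alpha,\beta$ the limit $$G_{\alpha\beta}(x-y)=\lim_{L\to\infty}\big(\Gamma^{(s),L}_d\big)_{(x,\alpha),(y,\beta)}$$ exists and depends on $x,y$ only through $x-y$, and there are constants $C,\xi>0$, depending only on the channel, with $|G_{\alpha\beta}(x)|\le C\,e^{-|x|/\xi}$ for all $x\in\mathbb Z$ and all $\alpha,\beta$. -/

import Mathlib

open Filter Topology
open scoped Matrix ComplexOrder

noncomputable section

/-- The correlation matrix `Γ` of a Gaussian fermion state on the modes `ι`: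
`Γ† = -Γ` and `Γ Γ† ≤ I`.  For `𝕜 = ℝ` this is a real antisymmetric matrix with `Γ Γᵀ ≤ I`
(Majorana modes); for `𝕜 = ℂ` it is the correlation matrix of one momentum sector. -/
structure IsCorrelationMatrix {𝕜 ι : Type*} [RCLike 𝕜] [Fintype ι] [DecidableEq ι]
    (Γ : Matrix ι ι 𝕜) : Prop where
  skew : Γᴴ = -Γ
  bounded : (1 - Γ * Γᴴ).PosSemidef

/-- The action `Γ ↦ A + B Γ B†` of a Gaussian fermion channel on correlation matrices. -/
def gaussianStep {𝕜 ι : Type*} [RCLike 𝕜] [Fintype ι]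
    (A B : Matrix ι ι 𝕜) (Γ : Matrix ι ι 𝕜) : Matrix ι ι 𝕜 :=
  A + B * Γ * Bᴴ

/-- The pair `(A, B)` defines a Gaussian fermion channel: `A` is antisymmetric and the complete
positivity and trace preservation condition `Λ† Λ ≤ I` holds, where `Λ = (A, B; -B†, 0)`. -/
structure IsGaussianChannel {𝕜 ι : Type*} [RCLike 𝕜] [Fintype ι] [DecidableEq ι]
    (A B : Matrix ι ι 𝕜) : Prop where
  skew : Aᴴ = -A
  cptp : (1 - (Matrix.fromBlocks A B (-Bᴴ) 0)ᴴ * Matrix.fromBlocks A B (-Bᴴ) 0).PosSemidef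

/-- The preserved modes `V_u`: the span of the eigenvectors of `B` whose eigenvalue has
modulus one. -/
def preservedModes {ι : Type*} [Fintype ι] [DecidableEq ι] (B : Matrix ι ι ℂ) :
    Submodule ℂ (EuclideanSpace ℂ ι) :=
  Submodule.span ℂ {v | ∃ b : ℂ, ‖b‖ = 1 ∧ Matrix.toEuclideanLin B v = b • v}

/-- The dissipative modes `V_d`: the orthogonal complement of the preserved modes. -/
def dissipativeModes {ι : Type*} [Fintype ι] [DecidableEq ι] (B : Matrix ι ι ℂ) :
    Submodule ℂ (EuclideanSpace ℂ ι) :=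
  (preservedModes B)ᗮ

/-- The matrix `P_d` of the orthogonal projection onto the dissipative modes. -/
def dissipativeProjector {ι : Type*} [Fintype ι] [DecidableEq ι] (B : Matrix ι ι ℂ) :
    Matrix ι ι ℂ :=
  Matrix.toEuclideanLin.symm ((dissipativeModes B).starProjection).toLinearMap

/-- `Γd` is the steady-state correlation matrix between the dissipative modes of the Gaussian
channel `(A, B)`: it is stationary, and for every initial correlation matrix `Γ₀` the dissipative
block of the evolved correlation matrix converges to `Γd`. (Since `Γ₀ = 0` is a correlation
matrix, there is at most one such `Γd`.) -/
structure IsDissipativeSteadyState {ι : Type*} [Fintype ι] [DecidableEq ι]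
    (A B Γd : Matrix ι ι ℂ) : Prop where
  stationary :
    Γd = dissipativeProjector B * gaussianStep A B Γd * dissipativeProjector B
  attracting : ∀ Γ₀ : Matrix ι ι ℂ, IsCorrelationMatrix Γ₀ →
    Tendsto
      (fun t : ℕ =>
        dissipativeProjector B * (gaussianStep A B)^[t] Γ₀ * dissipativeProjector B)
      atTop (𝓝 Γd)

/-- The translation-invariant matrix on a periodic ring of `L` unit cells with the finite-range
kernel `f`: a mode of cell `y` is coupled to a mode of cell `x` by the sum of all `f r` with
`r ≡ x - y` modulo `L`. -/
def ringMatrix {m : ℕ} (f : ℤ →₀ Matrix (Fin m) (Fin m) ℝ) (L : ℕ+) :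
    Matrix (ZMod L × Fin m) (ZMod L × Fin m) ℝ :=
  Matrix.of fun p q =>
    f.sum fun r M => if (r : ZMod L) = p.1 - q.1 then M p.2 q.2 else 0

/-- The momentum-space matrix `∑ r, e^{-ikr} f r` of the kernel `f`. -/
def momentumMatrix {m : ℕ} (f : ℤ →₀ Matrix (Fin m) (Fin m) ℝ) (k : ℝ) :
    Matrix (Fin m) (Fin m) ℂ :=
  f.sum fun r M => Complex.exp (-(Complex.I * k * r)) • M.map Complex.ofReal

/-- A translationally invariant 1D local Gaussian fermion channel with `m` Majorana modes per
unit cell: `a` and `b` are finite-range kernels, and on the periodic ring of `L` unit cells, for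
every `L ≥ 1`, they define a Gaussian fermion channel. The finite support of the kernels is the
locality. -/
structure LocalGaussianChannel (m : ℕ) where
  /-- the kernel of the noise matrix `A` -/
  a : ℤ →₀ Matrix (Fin m) (Fin m) ℝ
  /-- the kernel of the matrix `B` -/
  b : ℤ →₀ Matrix (Fin m) (Fin m) ℝ
  isChannel : ∀ L : ℕ+, IsGaussianChannel (ringMatrix a L) (ringMatrix b L)

/-- A matrix-valued function of the momentum `k` is analytic up to removable singularities: off
a set of momenta that is finite modulo `2π`, it agrees with a `2π`-periodic function that is
holomorphic in a strip around the real axis. -/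
def AnalyticUpToRemovable {m : ℕ} (F : ℝ → Matrix (Fin m) (Fin m) ℂ) : Prop :=
  (∀ k, F (k + 2 * Real.pi) = F k) ∧
  ∃ δ : ℝ, 0 < δ ∧ ∃ Φ : ℂ → Matrix (Fin m) (Fin m) ℂ,
    (∀ α β, DifferentiableOn ℂ (fun z => Φ z α β) {z : ℂ | |z.im| < δ}) ∧
    (∀ z, Φ (z + 2 * Real.pi) = Φ z) ∧
    {k : ℝ | k ∈ Set.Ico 0 (2 * Real.pi) ∧ F k ≠ Φ (k : ℂ)}.Finite

end

/-!
Write `Λ† Λ ≤ I` on vectors: `‖A v + B w‖² + ‖B† v‖² ≤ ‖v‖² + ‖w‖²` (`IsContractivePair`). An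
eigenvector of `B` with a unimodular eigenvalue is then an eigenvector of `B†` and is annihilated by
`A`. Hence the dissipative projector commutes with `B` and fixes `A`, and the powers of the
dissipative part of `B` decay geometrically. So the iterates of `Γ ↦ A + B Γ B†` converge between
dissipative modes to the series `steadyState A B = ∑ s, B ^ s A (B†) ^ s`
(`IsContractivePair.isDissipativeSteadyState`), whose entries are bounded by one because they are
limits of iterates of norm at most one.

The plane waves on the ring of `L` cells intertwine the ring matrices with the momentum matrices at
`k = 2 π j / L`. Therefore the momentum pairs are contractive at a dense set of momenta, thus at all
of them, and the steady state on the ring is the average over `j` of `e^{ik(x - y)} Γ_k`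
(`steadyState_ringMatrix_apply`).

Where modes are preserved, the linear equation `Γ = A_k + B_k Γ B_k†` is singular, possibly for all
`k`. Damping `B` by a factor `c < 1` makes it regular. Cramer's rule gives `p Γ = q` with `p`, `q`
polynomials in `e^{ik}` and `c` and `p ≠ 0`; dividing out powers of `c - 1` and letting `c → 1`
leaves `P Γ_k = Q` with polynomials in `e^{ik}` and `P ≠ 0` (`exists_polynomial_of_tendsto`). Since
`Γ_k` is bounded, the zeros of `P` on the unit circle cancel (`exists_cancel_zeros_on_circle`). So
`Γ_k` is, off finitely many momenta, a rational function of `e^{ik}` without poles on the circle,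
hence holomorphic on an annulus around it. In the thermodynamic limit the average over momenta
becomes a Laurent coefficient of this function, the exceptional momenta having vanishing weight, and
Laurent coefficients decay exponentially by moving the circle of integration.
-/

/-! ### Contractive pairs of matrices and their preserved modes -/

/-- The condition `Λ† Λ ≤ I` for `Λ = (A, B; -B†, 0)`, written out on vectors: `Λ` does not
increase the norm of `(v, w)`. -/
def IsContractivePair {ι : Type*} [Fintype ι] [DecidableEq ι] (A B : Matrix ι ι ℂ) : Prop :=
  ∀ v w : EuclideanSpace ℂ ι,
    ‖A.toEuclideanLin v + B.toEuclideanLin w‖ ^ 2 + ‖Bᴴ.toEuclideanLin v‖ ^ 2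
      ≤ ‖v‖ ^ 2 + ‖w‖ ^ 2

namespace IsContractivePair

variable {ι : Type*} [Fintype ι] [DecidableEq ι] {A B : Matrix ι ι ℂ}

lemma norm_le (h : IsContractivePair A B) (w : EuclideanSpace ℂ ι) :
    ‖B.toEuclideanLin w‖ ≤ ‖w‖ := by
  have := h 0 w
  simp only [map_zero, zero_add, norm_zero] at this
  exact le_of_sq_le_sq (by linarith) (norm_nonneg _)

lemma norm_sq_add_norm_sq_le (h : IsContractivePair A B) (v : EuclideanSpace ℂ ι) :
    ‖A.toEuclideanLin v‖ ^ 2 + ‖Bᴴ.toEuclideanLin v‖ ^ 2 ≤ ‖v‖ ^ 2 := by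
  simpa using h v 0

lemma inner_toEuclideanLin_conjTranspose (M : Matrix ι ι ℂ) (v w : EuclideanSpace ℂ ι) :
    inner ℂ (Mᴴ.toEuclideanLin v) w = inner ℂ v (M.toEuclideanLin w) := by
  rw [Matrix.toEuclideanLin_conjTranspose_eq_adjoint, LinearMap.adjoint_inner_left]

/-- An eigenvector of a contraction with a unimodular eigenvalue is an eigenvector of the
adjoint. -/
lemma conjTranspose_apply_of_eigenvector (h : IsContractivePair A B) {b : ℂ} (hb : ‖b‖ = 1)
    {v : EuclideanSpace ℂ ι} (hv : B.toEuclideanLin v = b • v) :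
    Bᴴ.toEuclideanLin v = (starRingEnd ℂ b) • v := by
  have h1 := h.norm_sq_add_norm_sq_le v
  have h2 : ‖Bᴴ.toEuclideanLin v - (starRingEnd ℂ b) • v‖ ^ 2
      = ‖Bᴴ.toEuclideanLin v‖ ^ 2 - ‖v‖ ^ 2 := by
    rw [@norm_sub_sq ℂ, inner_smul_right, inner_toEuclideanLin_conjTranspose, hv,
      inner_smul_right, ← mul_assoc, Complex.conj_mul', hb, norm_smul, RCLike.norm_conj, hb,
      inner_self_eq_norm_sq_to_K]
    simp only [Complex.ofReal_one, one_pow, one_mul, Complex.coe_algebraMap, RCLike.re_to_complex]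
    norm_cast
    ring
  have h3 : ‖Bᴴ.toEuclideanLin v - (starRingEnd ℂ b) • v‖ ^ 2 ≤ 0 := by
    nlinarith [sq_nonneg ‖A.toEuclideanLin v‖]
  have h4 := pow_eq_zero_iff (two_ne_zero) |>.1 (le_antisymm h3 (sq_nonneg _))
  exact sub_eq_zero.1 (norm_eq_zero.1 h4)

lemma apply_eq_zero_of_eigenvector (h : IsContractivePair A B) {b : ℂ} (hb : ‖b‖ = 1)
    {v : EuclideanSpace ℂ ι} (hv : B.toEuclideanLin v = b • v) :
    A.toEuclideanLin v = 0 := by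
  have h1 := h.norm_sq_add_norm_sq_le v
  rw [h.conjTranspose_apply_of_eigenvector hb hv, norm_smul, RCLike.norm_conj, hb, one_mul] at h1
  have h4 := pow_eq_zero_iff (two_ne_zero) |>.1
    (le_antisymm (by linarith : ‖A.toEuclideanLin v‖ ^ 2 ≤ 0) (sq_nonneg _))
  exact norm_eq_zero.1 h4

lemma apply_mem_preservedModes (v : EuclideanSpace ℂ ι) (hv : v ∈ preservedModes B) :
    B.toEuclideanLin v ∈ preservedModes B := by
  refine (Submodule.span_le (p := (preservedModes B).comap B.toEuclideanLin)).2 ?_ hv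
  rintro x ⟨b, hb, hx⟩
  rw [SetLike.mem_coe, Submodule.mem_comap, hx]
  exact Submodule.smul_mem _ _ (Submodule.subset_span ⟨b, hb, hx⟩)

lemma conjTranspose_apply_mem_preservedModes (h : IsContractivePair A B)
    (v : EuclideanSpace ℂ ι) (hv : v ∈ preservedModes B) :
    Bᴴ.toEuclideanLin v ∈ preservedModes B := by
  refine (Submodule.span_le (p := (preservedModes B).comap Bᴴ.toEuclideanLin)).2 ?_ hv
  rintro x ⟨b, hb, hx⟩
  rw [SetLike.mem_coe, Submodule.mem_comap, h.conjTranspose_apply_of_eigenvector hb hx]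
  exact Submodule.smul_mem _ _ (Submodule.subset_span ⟨b, hb, hx⟩)

lemma apply_eq_zero_of_mem_preservedModes (h : IsContractivePair A B)
    (v : EuclideanSpace ℂ ι) (hv : v ∈ preservedModes B) :
    A.toEuclideanLin v = 0 := by
  refine (Submodule.span_le (p := LinearMap.ker A.toEuclideanLin)).2 ?_ hv
  rintro x ⟨b, hb, hx⟩
  exact h.apply_eq_zero_of_eigenvector hb hx

lemma apply_mem_dissipativeModes (h : IsContractivePair A B)
    (v : EuclideanSpace ℂ ι) (hv : v ∈ dissipativeModes B) :
    B.toEuclideanLin v ∈ dissipativeModes B := by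
  refine (Submodule.mem_orthogonal _ _).2 fun u hu => ?_
  rw [← inner_toEuclideanLin_conjTranspose]
  exact (Submodule.mem_orthogonal _ _).1 hv _ (h.conjTranspose_apply_mem_preservedModes u hu)

lemma toEuclideanLin_dissipativeProjector (B : Matrix ι ι ℂ) (v : EuclideanSpace ℂ ι) :
    (dissipativeProjector B).toEuclideanLin v = (dissipativeModes B).starProjection v := by
  simp [dissipativeProjector]

/-- Every vector splits into a preserved part and a dissipative part, the latter being its image
under the dissipative projector. -/
lemma exists_decomposition (B : Matrix ι ι ℂ) (v : EuclideanSpace ℂ ι) :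
    ∃ u ∈ preservedModes B, ∃ d ∈ dissipativeModes B,
      v = u + d ∧ (dissipativeProjector B).toEuclideanLin v = d := by
  have hd := (dissipativeModes B).starProjection_apply_mem v
  have hu : v - (dissipativeModes B).starProjection v ∈ preservedModes B := by
    have := Submodule.sub_starProjection_mem_orthogonal (K := dissipativeModes B) v
    rwa [dissipativeModes, Submodule.orthogonal_orthogonal] at this
  exact ⟨_, hu, _, hd, by simp, toEuclideanLin_dissipativeProjector B v⟩

lemma dissipativeProjector_apply_add {u d : EuclideanSpace ℂ ι} (hu : u ∈ preservedModes B)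
    (hd : d ∈ dissipativeModes B) : (dissipativeProjector B).toEuclideanLin (u + d) = d := by
  rw [toEuclideanLin_dissipativeProjector, map_add,
    Submodule.starProjection_eq_self_iff.2 hd,
    (Submodule.starProjection_apply_eq_zero_iff _).2, zero_add]
  exact Submodule.le_orthogonal_orthogonal _ hu

/-- Both the preserved and the dissipative modes are invariant under `B`. -/
lemma dissipativeProjector_mul_comm (h : IsContractivePair A B) :
    dissipativeProjector B * B = B * dissipativeProjector B := by
  apply Matrix.toEuclideanLin.injective
  ext1 v
  obtain ⟨u, hu, d, hd, rfl, hP⟩ := exists_decomposition B v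
  rw [Matrix.toLpLin_mul_same, Matrix.toLpLin_mul_same, LinearMap.comp_apply,
    LinearMap.comp_apply, hP, map_add]
  exact dissipativeProjector_apply_add (apply_mem_preservedModes u hu)
    (h.apply_mem_dissipativeModes d hd)

lemma mul_dissipativeProjector (h : IsContractivePair A B) :
    A * dissipativeProjector B = A := by
  apply Matrix.toEuclideanLin.injective
  ext1 v
  obtain ⟨u, hu, d, hd, rfl, hP⟩ := exists_decomposition B v
  rw [Matrix.toLpLin_mul_same, LinearMap.comp_apply, hP, map_add,
    h.apply_eq_zero_of_mem_preservedModes u hu, zero_add]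

lemma conjTranspose_dissipativeProjector (B : Matrix ι ι ℂ) :
    (dissipativeProjector B)ᴴ = dissipativeProjector B := by
  apply Matrix.toEuclideanLin.injective
  rw [Matrix.toEuclideanLin_conjTranspose_eq_adjoint]
  symm
  rw [LinearMap.eq_adjoint_iff]
  intro x y
  rw [toEuclideanLin_dissipativeProjector, toEuclideanLin_dissipativeProjector]
  exact Submodule.inner_starProjection_left_eq_right _ _ _

lemma dissipativeProjector_mul_self (B : Matrix ι ι ℂ) :
    dissipativeProjector B * dissipativeProjector B = dissipativeProjector B := by
  apply Matrix.toEuclideanLin.injective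
  ext1 v
  obtain ⟨u, hu, d, hd, rfl, hP⟩ := exists_decomposition B v
  rw [Matrix.toLpLin_mul_same, LinearMap.comp_apply, hP]
  simpa using dissipativeProjector_apply_add (B := B) (Submodule.zero_mem _) hd

lemma dissipativeProjector_mul (h : IsContractivePair A B) (hA : Aᴴ = -A) :
    dissipativeProjector B * A = A := by
  have := congrArg Matrix.conjTranspose h.mul_dissipativeProjector
  rw [Matrix.conjTranspose_mul, conjTranspose_dissipativeProjector, hA, Matrix.mul_neg] at this
  exact neg_injective this

/-- On the dissipative modes `B` has no unimodular eigenvalue left. -/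
lemma norm_lt_one_of_mem_spectrum (h : IsContractivePair A B) {b : ℂ}
    (hb : b ∈ spectrum ℂ (B * dissipativeProjector B)) : ‖b‖ < 1 := by
  rw [← Matrix.spectrum_toLpLin 2, ← Module.End.hasEigenvalue_iff_mem_spectrum] at hb
  obtain ⟨v, hv⟩ := hb.exists_hasEigenvector
  have hv1 := hv.apply_eq_smul
  by_contra! hcon
  have hb0 : b ≠ 0 := by
    rintro rfl
    norm_num at hcon
  obtain ⟨u, hu, d, hd, rfl, hP⟩ := exists_decomposition B v
  rw [Matrix.toLpLin_mul_same, LinearMap.comp_apply, hP] at hv1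
  have hmem : u + d ∈ dissipativeModes B := by
    have : b • (u + d) ∈ dissipativeModes B := hv1 ▸ h.apply_mem_dissipativeModes d hd
    simpa [smul_smul, hb0] using Submodule.smul_mem _ b⁻¹ this
  have hu' : u ∈ dissipativeModes B := by simpa using Submodule.sub_mem _ hmem hd
  have hu0 : u = 0 := by
    have := (Submodule.mem_orthogonal _ _).1 hu' u hu
    exact inner_self_eq_zero.1 this
  subst hu0
  rw [zero_add] at hv1 hmem hv
  have hd0 : d ≠ 0 := hv.2
  have hb1 : ‖b‖ = 1 := by
    refine le_antisymm ?_ hcon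
    have := h.norm_le d
    rw [hv1, norm_smul] at this
    exact le_of_mul_le_mul_right (by simpa using this) (norm_pos_iff.2 hd0)
  exact hd0 (inner_self_eq_zero.1
    ((Submodule.mem_orthogonal _ _).1 hmem d (Submodule.subset_span ⟨b, hb1, hv1⟩)))

end IsContractivePair

/-! ### The dissipative steady state as a convergent series -/

/-- The series `∑ s, B ^ s A (B†) ^ s`, the limit of the channel `Γ ↦ A + B Γ B†` iterated on
`Γ = 0`. -/
noncomputable def steadyState {ι : Type*} [Fintype ι] [DecidableEq ι] (A B : Matrix ι ι ℂ) :
    Matrix ι ι ℂ :=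
  ∑' s : ℕ, B ^ s * A * Bᴴ ^ s

lemma gaussianStep_iterate {ι : Type*} [Fintype ι] [DecidableEq ι] (A B Γ : Matrix ι ι ℂ)
    (t : ℕ) : (gaussianStep A B)^[t] Γ
      = ∑ s ∈ Finset.range t, B ^ s * A * Bᴴ ^ s + B ^ t * Γ * Bᴴ ^ t := by
  induction t with
  | zero => simp
  | succ t ih =>
    rw [Function.iterate_succ_apply', ih, gaussianStep, Finset.sum_range_succ', mul_add, add_mul,
      Finset.mul_sum, Finset.sum_mul, pow_zero, pow_zero, one_mul, mul_one,
      add_comm _ A, add_assoc]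
    simp only [pow_succ' B, pow_succ Bᴴ, mul_assoc]

lemma continuous_mul_gaussianStep_mul {ι : Type*} [Fintype ι] (A B P : Matrix ι ι ℂ) :
    Continuous fun X : Matrix ι ι ℂ => P * gaussianStep A B X * P :=
  (continuous_const.matrix_mul (continuous_const.add
    ((continuous_const.matrix_mul continuous_id).matrix_mul continuous_const))).matrix_mul
    continuous_const

section Norm
open scoped Matrix.Norms.L2Operator

/-- A matrix whose spectrum lies in the open unit disc has geometrically decaying powers. -/
lemma exists_norm_pow_le_of_spectrum {ι : Type*} [Fintype ι] [DecidableEq ι] (M : Matrix ι ι ℂ)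
    (h : ∀ b ∈ spectrum ℂ M, ‖b‖ < 1) :
    ∃ r : ℝ, 0 ≤ r ∧ r < 1 ∧ ∀ᶠ n : ℕ in atTop, ‖M ^ n‖ ≤ r ^ n := by
  rcases isEmpty_or_nonempty ι with hι | hι
  · refine ⟨0, le_rfl, one_pos, Eventually.of_forall fun n => ?_⟩
    rw [Subsingleton.elim (M ^ n) 0, norm_zero]
    positivity
  have h1 : spectralRadius ℂ M < ((1 : NNReal) : ENNReal) :=
    spectrum.spectralRadius_lt_of_forall_lt M fun b hb => by
      rw [← NNReal.coe_lt_coe]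
      simpa using h b hb
  obtain ⟨r, hr0, hr1⟩ := ENNReal.lt_iff_exists_nnreal_btwn.1 h1
  refine ⟨r, r.2, by exact_mod_cast hr1, ?_⟩
  filter_upwards [(spectrum.pow_nnnorm_pow_one_div_tendsto_nhds_spectralRadius M).eventually_lt_const
    hr0, eventually_gt_atTop 0] with n hn hn0
  have hn' : (n : ℝ) ≠ 0 := by positivity
  have := ENNReal.rpow_le_rpow hn.le (Nat.cast_nonneg (α := ℝ) n)
  rw [← ENNReal.rpow_mul, one_div_mul_cancel hn', ENNReal.rpow_one, ENNReal.rpow_natCast] at this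
  exact_mod_cast this

namespace IsContractivePair

variable {ι : Type*} [Fintype ι] [DecidableEq ι] {A B : Matrix ι ι ℂ}

lemma dissipativeProjector_mul_pow (h : IsContractivePair A B) (s : ℕ) :
    dissipativeProjector B * B ^ s = B ^ s * dissipativeProjector B :=
  (show Commute (dissipativeProjector B) B from h.dissipativeProjector_mul_comm).pow_right s

lemma conjTranspose_pow_mul_dissipativeProjector (h : IsContractivePair A B) (s : ℕ) :
    Bᴴ ^ s * dissipativeProjector B = dissipativeProjector B * Bᴴ ^ s := by
  have := congrArg Matrix.conjTranspose (h.dissipativeProjector_mul_pow s)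
  simpa only [Matrix.conjTranspose_mul, conjTranspose_dissipativeProjector,
    Matrix.conjTranspose_pow] using this

lemma pow_mul_dissipativeProjector (h : IsContractivePair A B) (s : ℕ) :
    (B * dissipativeProjector B) ^ s * dissipativeProjector B
      = B ^ s * dissipativeProjector B := by
  rw [(show Commute B (dissipativeProjector B) from h.dissipativeProjector_mul_comm.symm).mul_pow,
    mul_assoc, ← pow_succ]
  congr 1
  exact (show IsIdempotentElem _ from dissipativeProjector_mul_self B).pow_succ_eq s

lemma dissipativeProjector_mul_conjTranspose_pow (h : IsContractivePair A B) (s : ℕ) :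
    dissipativeProjector B * (B * dissipativeProjector B)ᴴ ^ s
      = dissipativeProjector B * Bᴴ ^ s := by
  have := congrArg Matrix.conjTranspose (h.pow_mul_dissipativeProjector s)
  simpa only [Matrix.conjTranspose_mul, conjTranspose_dissipativeProjector,
    Matrix.conjTranspose_pow] using this

/-- The dissipative block of an evolved matrix only involves the dissipative part of `B`. -/
lemma dissipative_block_pow (h : IsContractivePair A B) (Γ : Matrix ι ι ℂ) (s : ℕ) :
    dissipativeProjector B * (B ^ s * Γ * Bᴴ ^ s) * dissipativeProjector B
      = (B * dissipativeProjector B) ^ s * (dissipativeProjector B * Γ * dissipativeProjector B)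
        * (B * dissipativeProjector B)ᴴ ^ s := by
  calc _ = (dissipativeProjector B * B ^ s) * Γ * (Bᴴ ^ s * dissipativeProjector B) := by
        simp only [mul_assoc]
    _ = (B ^ s * dissipativeProjector B) * Γ * (dissipativeProjector B * Bᴴ ^ s) := by
        rw [h.dissipativeProjector_mul_pow, h.conjTranspose_pow_mul_dissipativeProjector]
    _ = _ := by
        rw [← h.pow_mul_dissipativeProjector, ← h.dissipativeProjector_mul_conjTranspose_pow]
        simp only [mul_assoc]

lemma dissipative_block_term (h : IsContractivePair A B) (hA : Aᴴ = -A) (s : ℕ) :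
    dissipativeProjector B * (B ^ s * A * Bᴴ ^ s) * dissipativeProjector B
      = B ^ s * A * Bᴴ ^ s := by
  calc _ = (dissipativeProjector B * B ^ s) * A * (Bᴴ ^ s * dissipativeProjector B) := by
        simp only [mul_assoc]
    _ = B ^ s * ((dissipativeProjector B * A) * dissipativeProjector B) * Bᴴ ^ s := by
        rw [h.dissipativeProjector_mul_pow, h.conjTranspose_pow_mul_dissipativeProjector]
        simp only [mul_assoc]
    _ = _ := by rw [h.dissipativeProjector_mul hA, h.mul_dissipativeProjector]

lemma exists_norm_conj_pow_le (h : IsContractivePair A B) (Γ : Matrix ι ι ℂ) :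
    ∃ r : ℝ, 0 ≤ r ∧ r < 1 ∧ ∀ᶠ s : ℕ in atTop,
      ‖dissipativeProjector B * (B ^ s * Γ * Bᴴ ^ s) * dissipativeProjector B‖
        ≤ ‖dissipativeProjector B * Γ * dissipativeProjector B‖ * r ^ s := by
  obtain ⟨r, hr0, hr1, hr⟩ := exists_norm_pow_le_of_spectrum (B * dissipativeProjector B)
    fun b hb => h.norm_lt_one_of_mem_spectrum hb
  refine ⟨r, hr0, hr1, ?_⟩
  filter_upwards [hr] with s hs
  rw [h.dissipative_block_pow, ← Matrix.conjTranspose_pow]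
  set C := (B * dissipativeProjector B) ^ s
  have hC : ‖C‖ ≤ 1 := hs.trans (pow_le_one₀ hr0 hr1.le)
  calc _ ≤ ‖C‖ * ‖dissipativeProjector B * Γ * dissipativeProjector B‖ * ‖Cᴴ‖ :=
        (norm_mul_le _ _).trans (by gcongr; exact norm_mul_le _ _)
    _ = ‖dissipativeProjector B * Γ * dissipativeProjector B‖ * (‖C‖ * ‖C‖) := by
        rw [Matrix.l2_opNorm_conjTranspose]; ring
    _ ≤ _ := by
        gcongr
        calc ‖C‖ * ‖C‖ ≤ r ^ s * 1 := by gcongr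
          _ = r ^ s := mul_one _

lemma norm_apply_le_l2_opNorm {κ : Type*} [Fintype κ] [DecidableEq κ] (M : Matrix κ κ ℂ)
    (i j : κ) : ‖M i j‖ ≤ ‖M‖ := by
  have h1 := M.l2_opNorm_mulVec (EuclideanSpace.single j 1)
  rw [PiLp.norm_single, norm_one, mul_one] at h1
  refine le_trans ?_ h1
  refine le_trans (le_of_eq ?_) (PiLp.norm_apply_le _ i)
  simp

lemma exists_norm_conj_pow_apply_le (h : IsContractivePair A B) (Γ : Matrix ι ι ℂ) :
    ∃ K r : ℝ, 0 ≤ r ∧ r < 1 ∧ ∀ i j, ∀ᶠ s : ℕ in atTop,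
      ‖(dissipativeProjector B * (B ^ s * Γ * Bᴴ ^ s) * dissipativeProjector B) i j‖
        ≤ K * r ^ s := by
  obtain ⟨r, hr0, hr1, hr⟩ := h.exists_norm_conj_pow_le Γ
  exact ⟨_, r, hr0, hr1, fun i j =>
    hr.mono fun s hs => (norm_apply_le_l2_opNorm _ i j).trans hs⟩

end IsContractivePair

end Norm

namespace IsContractivePair

variable {ι : Type*} [Fintype ι] [DecidableEq ι] {A B : Matrix ι ι ℂ}

lemma summable_norm_steadyState_apply (h : IsContractivePair A B) (hA : Aᴴ = -A) (i j : ι) :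
    Summable fun s : ℕ => ‖(B ^ s * A * Bᴴ ^ s) i j‖ := by
  obtain ⟨K, r, hr0, hr1, hr⟩ := h.exists_norm_conj_pow_apply_le A
  refine Summable.of_norm_bounded_eventually_nat
    ((summable_geometric_of_lt_one hr0 hr1).mul_left K) ?_
  filter_upwards [hr i j] with s hs
  rwa [h.dissipative_block_term hA, ← norm_norm] at hs

lemma hasSum_steadyState (h : IsContractivePair A B) (hA : Aᴴ = -A) :
    HasSum (fun s : ℕ => B ^ s * A * Bᴴ ^ s) (steadyState A B) :=
  Summable.hasSum <| Pi.summable.2 fun i => Pi.summable.2 fun j =>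
    (h.summable_norm_steadyState_apply hA i j).of_norm

lemma tendsto_conj_pow (h : IsContractivePair A B) (Γ : Matrix ι ι ℂ) :
    Tendsto (fun s : ℕ =>
      dissipativeProjector B * (B ^ s * Γ * Bᴴ ^ s) * dissipativeProjector B) atTop (𝓝 0) := by
  obtain ⟨K, r, hr0, hr1, hr⟩ := h.exists_norm_conj_pow_apply_le Γ
  refine tendsto_pi_nhds.2 fun i => tendsto_pi_nhds.2 fun j => squeeze_zero_norm' (hr i j) ?_
  simpa using (tendsto_pow_atTop_nhds_zero_of_lt_one hr0 hr1).const_mul K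

lemma mul_gaussianStep_iterate_mul (A B P Γ : Matrix ι ι ℂ) (t : ℕ) :
    P * (gaussianStep A B)^[t] Γ * P
      = ∑ s ∈ Finset.range t, P * (B ^ s * A * Bᴴ ^ s) * P + P * (B ^ t * Γ * Bᴴ ^ t) * P := by
  rw [gaussianStep_iterate, mul_add, add_mul, Finset.mul_sum, Finset.sum_mul]

lemma tendsto_dissipative_block (h : IsContractivePair A B) (hA : Aᴴ = -A) (Γ : Matrix ι ι ℂ) :
    Tendsto (fun t : ℕ =>
      dissipativeProjector B * (gaussianStep A B)^[t] Γ * dissipativeProjector B) atTop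
      (𝓝 (steadyState A B)) := by
  have h1 := (h.hasSum_steadyState hA).tendsto_sum_nat.add (h.tendsto_conj_pow Γ)
  rw [add_zero] at h1
  refine Tendsto.congr (fun t => ?_) h1
  rw [mul_gaussianStep_iterate_mul]
  exact congrArg (· + _) (Finset.sum_congr rfl fun s _ => (h.dissipative_block_term hA s).symm)

lemma gaussianStep_sum (A B : Matrix ι ι ℂ) (t : ℕ) :
    gaussianStep A B (∑ s ∈ Finset.range t, B ^ s * A * Bᴴ ^ s)
      = (gaussianStep A B)^[t + 1] 0 := by
  rw [Function.iterate_succ_apply', gaussianStep_iterate, mul_zero, zero_mul, add_zero]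

/-- The series `steadyState A B` is the steady-state correlation matrix between the dissipative
modes. -/
lemma isDissipativeSteadyState (h : IsContractivePair A B) (hA : Aᴴ = -A) :
    IsDissipativeSteadyState A B (steadyState A B) where
  attracting Γ _ := h.tendsto_dissipative_block hA Γ
  stationary := by
    have h1 := (h.hasSum_steadyState hA).tendsto_sum_nat
    have h2 := (tendsto_add_atTop_iff_nat 1).2 (h.tendsto_dissipative_block hA 0)
    have h3 := ((continuous_mul_gaussianStep_mul A B (dissipativeProjector B)).tendsto _).comp h1
    refine tendsto_nhds_unique h2 (Tendsto.congr (fun t => ?_) h3)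
    rw [Function.comp_apply, gaussianStep_sum]

/-- The iterates of the channel started at `Γ = 0` have norm at most one. -/
lemma norm_gaussianStep_iterate_le (h : IsContractivePair A B) (t : ℕ)
    (v : EuclideanSpace ℂ ι) :
    ‖((gaussianStep A B)^[t] 0).toEuclideanLin v‖ ≤ ‖v‖ := by
  induction t generalizing v with
  | zero => simp
  | succ t ih =>
    rw [Function.iterate_succ_apply']
    set X := (gaussianStep A B)^[t] 0
    -- with `w = X B† v` the term `‖B† v‖²` on the left compensates `‖w‖²` on the right
    have h1 := h v (X.toEuclideanLin (Bᴴ.toEuclideanLin v))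
    have h2 := ih (Bᴴ.toEuclideanLin v)
    have h3 : (gaussianStep A B X).toEuclideanLin v
        = A.toEuclideanLin v + B.toEuclideanLin (X.toEuclideanLin (Bᴴ.toEuclideanLin v)) := by
      simp only [gaussianStep, map_add, Matrix.toLpLin_mul_same, LinearMap.add_apply,
        LinearMap.comp_apply]
    rw [h3]
    refine le_of_sq_le_sq ?_ (norm_nonneg _)
    have h4 := pow_le_pow_left₀ (norm_nonneg _) h2 2
    linarith

/-- The steady state is a limit of correlation matrices, so its entries are bounded by one. -/
lemma norm_steadyState_apply_le (h : IsContractivePair A B) (hA : Aᴴ = -A) (i j : ι) :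
    ‖steadyState A B i j‖ ≤ 1 := by
  have h1 := (h.hasSum_steadyState hA).tendsto_sum_nat
  have h2 : Tendsto (fun t : ℕ => (∑ s ∈ Finset.range t, B ^ s * A * Bᴴ ^ s) i j) atTop
      (𝓝 (steadyState A B i j)) := (tendsto_pi_nhds.1 (tendsto_pi_nhds.1 h1 i)) j
  refine le_of_tendsto h2.norm (Eventually.of_forall fun t => ?_)
  have h3 : (gaussianStep A B)^[t] 0 = ∑ s ∈ Finset.range t, B ^ s * A * Bᴴ ^ s := by
    rw [gaussianStep_iterate]; simp
  have h4 := h.norm_gaussianStep_iterate_le t (EuclideanSpace.single j 1)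
  rw [h3] at h4
  set M := ∑ s ∈ Finset.range t, B ^ s * A * Bᴴ ^ s
  have h5 := (PiLp.norm_apply_le _ i).trans h4
  simpa [Matrix.toLpLin_apply] using h5

end IsContractivePair

/-! ### Real Gaussian channels as contractive pairs -/

lemma IsGaussianChannel.sum_sq_le {κ : Type*} [Fintype κ] [DecidableEq κ]
    {A B : Matrix κ κ ℝ} (h : IsGaussianChannel A B) (x y : κ → ℝ) :
    ∑ i, (A *ᵥ x + B *ᵥ y) i ^ 2 + ∑ i, (Bᴴ *ᵥ x) i ^ 2 ≤ ∑ i, x i ^ 2 + ∑ i, y i ^ 2 := by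
  have h1 := h.cptp.dotProduct_mulVec_nonneg (Sum.elim x y)
  rw [Matrix.sub_mulVec, Matrix.one_mulVec, dotProduct_sub, ← Matrix.mulVec_mulVec,
    Matrix.dotProduct_mulVec, Matrix.vecMul_conjTranspose, star_star, Matrix.fromBlocks_mulVec] at h1
  simp only [Sum.elim_comp_inl, Sum.elim_comp_inr, Matrix.zero_mulVec, add_zero,
    Matrix.neg_mulVec, dotProduct, Fintype.sum_sum_type, Pi.star_apply, star_trivial,
    Sum.elim_inl, Sum.elim_inr, Pi.neg_apply, neg_mul_neg] at h1
  simp only [pow_two]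
  linarith

lemma ofReal_map_mulVec_re {κ κ' : Type*} [Fintype κ'] (M : Matrix κ κ' ℝ) (v : κ' → ℂ)
    (i : κ) : ((M.map Complex.ofReal *ᵥ v) i).re = (M *ᵥ fun j => (v j).re) i := by
  simp [Matrix.mulVec, dotProduct]

lemma ofReal_map_mulVec_im {κ κ' : Type*} [Fintype κ'] (M : Matrix κ κ' ℝ) (v : κ' → ℂ)
    (i : κ) : ((M.map Complex.ofReal *ᵥ v) i).im = (M *ᵥ fun j => (v j).im) i := by
  simp [Matrix.mulVec, dotProduct]

lemma conjTranspose_ofReal_map {κ κ' : Type*} (M : Matrix κ κ' ℝ) :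
    (M.map Complex.ofReal)ᴴ = Mᴴ.map Complex.ofReal := by
  ext i j
  simp

/-- A real matrix acts separately on the real and the imaginary part of a vector. -/
lemma IsGaussianChannel.isContractivePair {κ : Type*} [Fintype κ] [DecidableEq κ]
    {A B : Matrix κ κ ℝ} (h : IsGaussianChannel A B) :
    IsContractivePair (A.map Complex.ofReal) (B.map Complex.ofReal) := by
  intro v w
  have h1 := h.sum_sq_le (fun j => (v j).re) (fun j => (w j).re)
  have h2 := h.sum_sq_le (fun j => (v j).im) (fun j => (w j).im)
  rw [conjTranspose_ofReal_map]
  simp only [EuclideanSpace.norm_sq_eq, Complex.sq_norm, Complex.normSq_apply, ← pow_two,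
    PiLp.add_apply, Complex.add_re, Complex.add_im, Matrix.ofLp_toLpLin, Matrix.toLin'_apply,
    ofReal_map_mulVec_re, ofReal_map_mulVec_im, Finset.sum_add_distrib]
  simp only [Pi.add_apply] at h1 h2
  linarith

lemma IsGaussianChannel.conjTranspose_map {κ : Type*} [Fintype κ] [DecidableEq κ]
    {A B : Matrix κ κ ℝ} (h : IsGaussianChannel A B) :
    (A.map Complex.ofReal)ᴴ = -A.map Complex.ofReal := by
  rw [conjTranspose_ofReal_map, h.skew]
  ext i j
  simp

section

/-! ### Plane waves on the ring -/

/-- The matrix whose columns are the plane waves of momentum `2 π j / L` on the ring of `L` unit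
cells, one for each mode of the unit cell. -/
noncomputable def planeWave (m : ℕ) (L : ℕ+) (j : ZMod L) :
    Matrix (ZMod L × Fin m) (Fin m) ℂ :=
  Matrix.of fun p α => if p.2 = α then ZMod.stdAddChar (j * p.1) else 0

/-- The momentum `2 π j / L` of the `j`-th plane wave. -/
noncomputable def ringMomentum (L : ℕ+) (j : ZMod L) : ℝ := 2 * Real.pi * (j.val / L)

lemma stdAddChar_mul_intCast (L : ℕ+) (j : ZMod L) (r : ℤ) :
    ZMod.stdAddChar (j * (r : ZMod L)) = Complex.exp (Complex.I * ringMomentum L j * r) := by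
  have : j * (r : ZMod L) = (((j.val : ℤ) * r : ℤ) : ZMod L) := by simp
  rw [this, ZMod.stdAddChar_coe, ringMomentum]
  congr 1
  push_cast
  ring

lemma conj_stdAddChar (L : ℕ+) (j : ZMod L) :
    (starRingEnd ℂ) (ZMod.stdAddChar j) = ZMod.stdAddChar (-j) := by
  rw [ZMod.stdAddChar_apply, ZMod.stdAddChar_apply, AddChar.map_neg_eq_inv, Circle.coe_inv_eq_conj]

variable {m : ℕ}

lemma momentumMatrix_apply (f : ℤ →₀ Matrix (Fin m) (Fin m) ℝ) (k : ℝ) (α β : Fin m) :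
    momentumMatrix f k α β
      = ∑ r ∈ f.support, Complex.exp (-(Complex.I * k * r)) * (f r α β : ℂ) := by
  simp [momentumMatrix, Finsupp.sum, Matrix.sum_apply]

lemma ringMatrix_apply (f : ℤ →₀ Matrix (Fin m) (Fin m) ℝ) (L : ℕ+) (p q : ZMod L × Fin m) :
    ringMatrix f L p q
      = ∑ r ∈ f.support, if (r : ZMod L) = p.1 - q.1 then f r p.2 q.2 else 0 := rfl

lemma momentumMatrix_ringMomentum (f : ℤ →₀ Matrix (Fin m) (Fin m) ℝ) (L : ℕ+) (j : ZMod L)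
    (α β : Fin m) : momentumMatrix f (ringMomentum L j) α β
      = ∑ r ∈ f.support, ZMod.stdAddChar (-(j * (r : ZMod L))) * (f r α β : ℂ) := by
  rw [momentumMatrix_apply]
  refine Finset.sum_congr rfl fun r _ => ?_
  rw [AddChar.map_neg_eq_inv, stdAddChar_mul_intCast, Complex.exp_neg]

/-- Translation-invariant matrices act on plane waves through their momentum-space matrix. -/
lemma ringMatrix_mul_planeWave (f : ℤ →₀ Matrix (Fin m) (Fin m) ℝ) (L : ℕ+) (j : ZMod L) :
    (ringMatrix f L).map Complex.ofReal * planeWave m L j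
      = planeWave m L j * momentumMatrix f (ringMomentum L j) := by
  ext ⟨x, α⟩ β
  simp only [Matrix.mul_apply, Fintype.sum_prod_type, planeWave, Matrix.of_apply, Matrix.map_apply,
    mul_ite, mul_zero, Finset.sum_ite_eq', Finset.mem_univ, if_true, ite_mul,
    zero_mul, Finset.sum_ite_eq]
  simp only [ringMatrix_apply, momentumMatrix_ringMomentum, Finset.mul_sum,
    Complex.ofReal_sum, Finset.sum_mul]
  rw [Finset.sum_comm]
  refine Finset.sum_congr rfl fun r _ => ?_
  rw [Finset.sum_eq_single (x - (r : ZMod L))]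
  · rw [if_pos (by simp), mul_sub, sub_eq_add_neg, AddChar.map_add_eq_mul]
    ring
  · intro y _ hy
    rw [if_neg, Complex.ofReal_zero, zero_mul]
    rintro h
    exact hy (by rw [h]; abel)
  · simp

lemma conjTranspose_planeWave_mul_ringMatrix (f : ℤ →₀ Matrix (Fin m) (Fin m) ℝ) (L : ℕ+)
    (j : ZMod L) : (planeWave m L j)ᴴ * (ringMatrix f L).map Complex.ofReal
      = momentumMatrix f (ringMomentum L j) * (planeWave m L j)ᴴ := by
  ext α ⟨y, β⟩
  simp only [Matrix.mul_apply, Fintype.sum_prod_type, planeWave, Matrix.of_apply, Matrix.map_apply,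
    Matrix.conjTranspose_apply, apply_ite star, star_zero, mul_ite, mul_zero,
    Finset.sum_ite_eq', Finset.mem_univ, if_true, ite_mul, zero_mul, Finset.sum_ite_eq]
  simp only [ringMatrix_apply, momentumMatrix_ringMomentum, Finset.mul_sum,
    Complex.ofReal_sum, Finset.sum_mul]
  rw [Finset.sum_comm]
  refine Finset.sum_congr rfl fun r _ => ?_
  rw [Finset.sum_eq_single (y + (r : ZMod L))]
  · rw [if_pos (by simp), ← starRingEnd_apply, ← starRingEnd_apply, conj_stdAddChar,
      conj_stdAddChar, mul_add, neg_add, AddChar.map_add_eq_mul]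
    ring
  · intro x _ hx
    rw [if_neg, Complex.ofReal_zero, mul_zero]
    rintro h
    exact hx (by rw [h]; abel)
  · simp

lemma conjTranspose_ringMatrix_mul_planeWave (f : ℤ →₀ Matrix (Fin m) (Fin m) ℝ) (L : ℕ+)
    (j : ZMod L) : ((ringMatrix f L).map Complex.ofReal)ᴴ * planeWave m L j
      = planeWave m L j * (momentumMatrix f (ringMomentum L j))ᴴ := by
  have := congrArg Matrix.conjTranspose (conjTranspose_planeWave_mul_ringMatrix f L j)
  simpa only [Matrix.conjTranspose_mul, Matrix.conjTranspose_conjTranspose] using this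

lemma conjTranspose_planeWave_mul_self (L : ℕ+) (j : ZMod L) :
    (planeWave m L j)ᴴ * planeWave m L j = (L : ℂ) • 1 := by
  ext α β
  simp only [Matrix.mul_apply, Fintype.sum_prod_type, planeWave, Matrix.of_apply,
    Matrix.conjTranspose_apply, apply_ite star, star_zero, mul_ite, mul_zero, ite_mul, zero_mul,
    Finset.sum_ite_eq', Finset.mem_univ, if_true, Matrix.smul_apply,
    Matrix.one_apply, smul_eq_mul, mul_one]
  simp only [← starRingEnd_apply, conj_stdAddChar, ← AddChar.map_add_eq_mul]
  by_cases h : α = β <;> simp [h, eq_comm]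

lemma sum_planeWave_mul_conjTranspose (L : ℕ+) :
    ∑ j : ZMod L, planeWave m L j * (planeWave m L j)ᴴ = (L : ℂ) • 1 := by
  ext ⟨x, α⟩ ⟨y, β⟩
  simp only [Matrix.mul_apply, planeWave, Matrix.of_apply, Matrix.sum_apply,
    Matrix.conjTranspose_apply, apply_ite star, star_zero, mul_ite, mul_zero, ite_mul, zero_mul,
    Finset.sum_ite_eq, Finset.mem_univ, if_true, Matrix.smul_apply,
    Matrix.one_apply, smul_eq_mul, mul_one, Prod.mk.injEq]
  have h1 := AddChar.sum_mulShift (x - y) (ZMod.isPrimitive_stdAddChar (L : ℕ))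
  by_cases h : α = β
  · subst h
    have h2 : ∀ j : ZMod L, ZMod.stdAddChar (j * x) * star (ZMod.stdAddChar (j * y))
        = ZMod.stdAddChar (j * (x - y)) := fun j => by
      rw [← starRingEnd_apply, conj_stdAddChar, ← AddChar.map_add_eq_mul, mul_sub, sub_eq_add_neg]
    simp only [if_true, and_true, h2]
    simpa [sub_eq_zero] using h1
  · simp [h]

/-! ### The momentum sectors -/

lemma norm_sq_planeWave_apply (L : ℕ+) (j : ZMod L) (v : EuclideanSpace ℂ (Fin m)) :
    ‖(planeWave m L j).toEuclideanLin v‖ ^ 2 = L * ‖v‖ ^ 2 := by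
  have h : inner ℂ ((planeWave m L j).toEuclideanLin v) ((planeWave m L j).toEuclideanLin v)
      = (L : ℂ) * inner ℂ v v := by
    rw [← LinearMap.adjoint_inner_right, ← Matrix.toEuclideanLin_conjTranspose_eq_adjoint,
      ← LinearMap.comp_apply, ← Matrix.toLpLin_mul_same, conjTranspose_planeWave_mul_self, map_smul,
      Matrix.toLpLin_one, LinearMap.smul_apply, inner_smul_right]
    simp
  rw [inner_self_eq_norm_sq_to_K, inner_self_eq_norm_sq_to_K] at h
  apply Complex.ofReal_injective
  push_cast
  simpa using h

/-- A momentum sector inherits contractivity from the ring on which its plane waves live. -/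
lemma isContractivePair_momentumMatrix_ringMomentum (N : LocalGaussianChannel m) (L : ℕ+)
    (j : ZMod L) : IsContractivePair (momentumMatrix N.a (ringMomentum L j))
      (momentumMatrix N.b (ringMomentum L j)) := by
  intro v w
  have h := (N.isChannel L).isContractivePair ((planeWave m L j).toEuclideanLin v)
    ((planeWave m L j).toEuclideanLin w)
  simp only [← LinearMap.comp_apply, ← Matrix.toLpLin_mul_same, ringMatrix_mul_planeWave,
    conjTranspose_ringMatrix_mul_planeWave] at h
  simp only [Matrix.toLpLin_mul_same, LinearMap.comp_apply, ← map_add,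
    norm_sq_planeWave_apply] at h
  have hL : (0 : ℝ) < L := by exact_mod_cast L.pos
  exact le_of_mul_le_mul_left (by linarith) hL

lemma exists_ringMomentum_two_pi_mul_ratCast (q : ℚ) : ∃ (L : ℕ+) (j : ZMod L),
    ∀ f : ℤ →₀ Matrix (Fin m) (Fin m) ℝ,
      momentumMatrix f (2 * Real.pi * q) = momentumMatrix f (ringMomentum L j) := by
  obtain ⟨L, hL⟩ : ∃ L : ℕ+, (L : ℕ) = q.den := ⟨⟨q.den, q.den_pos⟩, rfl⟩
  refine ⟨L, (q.num : ZMod L), fun f => ?_⟩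
  ext α β
  rw [momentumMatrix_ringMomentum, momentumMatrix_apply]
  refine Finset.sum_congr rfl fun r _ => ?_
  have h : -((q.num : ZMod L) * (r : ZMod L)) = ((-(q.num * r) : ℤ) : ZMod L) := by
    simp
  rw [h, ZMod.stdAddChar_coe, hL]
  congr 2
  rw [Rat.cast_def q]
  push_cast
  ring

lemma continuous_momentumMatrix (f : ℤ →₀ Matrix (Fin m) (Fin m) ℝ) :
    Continuous (momentumMatrix f) := by
  refine continuous_pi fun α => continuous_pi fun β => ?_
  simp only [momentumMatrix_apply]
  fun_prop

lemma continuous_toEuclideanLin_apply {X κ κ' : Type*} [TopologicalSpace X] [Fintype κ]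
    [DecidableEq κ] [Fintype κ'] {M : X → Matrix κ' κ ℂ} (hM : Continuous M)
    (v : EuclideanSpace ℂ κ) : Continuous fun x => (M x).toEuclideanLin v := by
  simp only [Matrix.toLpLin_apply]
  exact (PiLp.continuous_toLp 2 _).comp (hM.matrix_mulVec continuous_const)

/-- The momenta of the rings are dense, so every momentum sector is contractive. -/
lemma isContractivePair_momentumMatrix (N : LocalGaussianChannel m) (k : ℝ) :
    IsContractivePair (momentumMatrix N.a k) (momentumMatrix N.b k) := by
  intro v w
  have hd : DenseRange fun q : ℚ => 2 * Real.pi * (q : ℝ) :=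
    (mul_left_surjective₀ Real.two_pi_pos.ne').denseRange.comp Rat.denseRange_cast
      (continuous_const_mul _)
  have ha := continuous_toEuclideanLin_apply (continuous_momentumMatrix N.a) v
  have hb := continuous_toEuclideanLin_apply (continuous_momentumMatrix N.b) w
  have hb' := continuous_toEuclideanLin_apply (continuous_momentumMatrix N.b).matrix_conjTranspose v
  refine hd.induction_on (p := fun k => ‖(momentumMatrix N.a k).toEuclideanLin v
    + (momentumMatrix N.b k).toEuclideanLin w‖ ^ 2 + ‖(momentumMatrix N.b k)ᴴ.toEuclideanLin v‖ ^ 2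
      ≤ ‖v‖ ^ 2 + ‖w‖ ^ 2) k ?_ fun q => ?_
  · exact isClosed_le (((ha.add hb).norm.pow 2).add (hb'.norm.pow 2)) continuous_const
  · obtain ⟨L, j, hq⟩ := exists_ringMomentum_two_pi_mul_ratCast (m := m) q
    rw [hq, hq]
    exact isContractivePair_momentumMatrix_ringMomentum N _ _ v w

lemma conjTranspose_momentumMatrix_ringMomentum (N : LocalGaussianChannel m) (L : ℕ+)
    (j : ZMod L) : (momentumMatrix N.a (ringMomentum L j))ᴴ
      = -momentumMatrix N.a (ringMomentum L j) := by
  have hL : (L : ℂ) ≠ 0 := by exact_mod_cast L.ne_zero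
  have h1 := conjTranspose_ringMatrix_mul_planeWave N.a L j
  rw [(N.isChannel L).conjTranspose_map, Matrix.neg_mul, ringMatrix_mul_planeWave] at h1
  have h2 := congrArg ((planeWave m L j)ᴴ * ·) h1
  simp only [Matrix.mul_neg, ← Matrix.mul_assoc, conjTranspose_planeWave_mul_self,
    Matrix.smul_mul, Matrix.one_mul, ← smul_neg] at h2
  exact (smul_right_injective _ hL h2).symm

lemma conjTranspose_momentumMatrix (N : LocalGaussianChannel m) (k : ℝ) :
    (momentumMatrix N.a k)ᴴ = -momentumMatrix N.a k := by
  have hd : DenseRange fun q : ℚ => 2 * Real.pi * (q : ℝ) :=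
    (mul_left_surjective₀ Real.two_pi_pos.ne').denseRange.comp Rat.denseRange_cast
      (continuous_const_mul _)
  refine hd.induction_on (p := fun k => (momentumMatrix N.a k)ᴴ = -momentumMatrix N.a k) k
    ?_ fun q => ?_
  · exact isClosed_eq (continuous_momentumMatrix N.a).matrix_conjTranspose
      (continuous_momentumMatrix N.a).neg
  · obtain ⟨L, j, hq⟩ := exists_ringMomentum_two_pi_mul_ratCast (m := m) q
    rw [hq]
    exact conjTranspose_momentumMatrix_ringMomentum N _ _

lemma momentumMatrix_add_two_pi (f : ℤ →₀ Matrix (Fin m) (Fin m) ℝ) (k : ℝ) :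
    momentumMatrix f (k + 2 * Real.pi) = momentumMatrix f k := by
  ext α β
  rw [momentumMatrix_apply, momentumMatrix_apply]
  refine Finset.sum_congr rfl fun r _ => ?_
  congr 1
  refine Complex.exp_eq_exp_iff_exists_int.2 ⟨-r, ?_⟩
  push_cast
  ring

lemma pow_mul_of_mul_eq {κ κ' R : Type*} [Fintype κ] [DecidableEq κ] [Fintype κ']
    [DecidableEq κ'] [Semiring R] {M : Matrix κ κ R} {W : Matrix κ κ' R} {M' : Matrix κ' κ' R}
    (h : M * W = W * M') (s : ℕ) : M ^ s * W = W * M' ^ s := by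
  induction s with
  | zero => simp
  | succ s ih => rw [pow_succ, Matrix.mul_assoc, h, ← Matrix.mul_assoc, ih, Matrix.mul_assoc,
      ← pow_succ]

lemma ringMatrix_term (N : LocalGaussianChannel m) (L : ℕ+) (s : ℕ) :
    ∑ j : ZMod L, planeWave m L j * (momentumMatrix N.b (ringMomentum L j) ^ s
        * momentumMatrix N.a (ringMomentum L j) * (momentumMatrix N.b (ringMomentum L j))ᴴ ^ s)
        * (planeWave m L j)ᴴ
      = (L : ℂ) • ((ringMatrix N.b L).map Complex.ofReal ^ s * (ringMatrix N.a L).map Complex.ofReal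
        * ((ringMatrix N.b L).map Complex.ofReal)ᴴ ^ s) := by
  set A := (ringMatrix N.a L).map Complex.ofReal
  set B := (ringMatrix N.b L).map Complex.ofReal
  have h : ∀ j, planeWave m L j * (momentumMatrix N.b (ringMomentum L j) ^ s
        * momentumMatrix N.a (ringMomentum L j) * (momentumMatrix N.b (ringMomentum L j))ᴴ ^ s)
        * (planeWave m L j)ᴴ = B ^ s * A * (planeWave m L j * (planeWave m L j)ᴴ) * Bᴴ ^ s := by
    intro j
    have h1 := pow_mul_of_mul_eq (ringMatrix_mul_planeWave N.b L j) s
    have h2 := congrArg Matrix.conjTranspose h1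
    rw [Matrix.conjTranspose_mul, Matrix.conjTranspose_mul, Matrix.conjTranspose_pow,
      Matrix.conjTranspose_pow] at h2
    calc _ = (planeWave m L j * momentumMatrix N.b (ringMomentum L j) ^ s)
          * momentumMatrix N.a (ringMomentum L j)
          * ((momentumMatrix N.b (ringMomentum L j))ᴴ ^ s * (planeWave m L j)ᴴ) := by
          simp only [Matrix.mul_assoc]
      _ = B ^ s * (planeWave m L j * momentumMatrix N.a (ringMomentum L j))
          * ((planeWave m L j)ᴴ * Bᴴ ^ s) := by
          rw [← h1, ← h2]
          simp only [Matrix.mul_assoc]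
          rfl
      _ = _ := by
          rw [← ringMatrix_mul_planeWave]
          simp only [Matrix.mul_assoc]
          rfl
  rw [Finset.sum_congr rfl fun j _ => h j, ← Finset.sum_mul, ← Finset.mul_sum,
    sum_planeWave_mul_conjTranspose, mul_smul_comm, smul_mul_assoc, mul_one]

lemma HasSum.conj_planeWave {L : ℕ+} {f : ℕ → Matrix (Fin m) (Fin m) ℂ}
    {S : Matrix (Fin m) (Fin m) ℂ} (h : HasSum f S) (j : ZMod L) :
    HasSum (fun s => planeWave m L j * f s * (planeWave m L j)ᴴ)
      (planeWave m L j * S * (planeWave m L j)ᴴ) :=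
  let F : Matrix (Fin m) (Fin m) ℂ →+ Matrix (ZMod L × Fin m) (ZMod L × Fin m) ℂ :=
    AddMonoidHom.mk' (fun X => planeWave m L j * X * (planeWave m L j)ᴴ)
      fun X Y => by rw [Matrix.mul_add, Matrix.add_mul]
  h.map F ((continuous_const.matrix_mul continuous_id).matrix_mul continuous_const)

/-- The steady state on the ring is the direct sum of those of its momentum sectors. -/
lemma steadyState_ringMatrix_apply (N : LocalGaussianChannel m) (L : ℕ+)
    (x y : ZMod L) (α β : Fin m) :
    steadyState ((ringMatrix N.a L).map Complex.ofReal) ((ringMatrix N.b L).map Complex.ofReal)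
      (x, α) (y, β)
      = (L : ℂ)⁻¹ * ∑ j : ZMod L, ZMod.stdAddChar (j * (x - y))
        * steadyState (momentumMatrix N.a (ringMomentum L j))
          (momentumMatrix N.b (ringMomentum L j)) α β := by
  have hL : (L : ℂ) ≠ 0 := by exact_mod_cast L.ne_zero
  have h1 := ((N.isChannel L).isContractivePair.hasSum_steadyState
    (N.isChannel L).conjTranspose_map).const_smul (L : ℂ)
  have h2 := hasSum_sum (s := Finset.univ) fun (j : ZMod L) _ =>
    ((isContractivePair_momentumMatrix N (ringMomentum L j)).hasSum_steadyState
      (conjTranspose_momentumMatrix N _)).conj_planeWave j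
  simp only [ringMatrix_term] at h2
  have h3 := congrFun (congrFun (h1.unique h2) (x, α)) (y, β)
  rw [eq_inv_mul_iff_mul_eq₀ hL]
  refine h3.trans ?_
  rw [Matrix.sum_apply]
  refine Finset.sum_congr rfl fun j _ => ?_
  simp only [Matrix.mul_apply, planeWave, Matrix.of_apply, Matrix.conjTranspose_apply,
    apply_ite star, star_zero, mul_ite, mul_zero, ite_mul, zero_mul, Finset.sum_ite_eq,
    Finset.mem_univ, if_true]
  rw [← starRingEnd_apply, conj_stdAddChar, mul_sub, sub_eq_add_neg, AddChar.map_add_eq_mul]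
  ring

end

/-! ### Damping the channel -/

namespace IsContractivePair

variable {ι : Type*} [Fintype ι] [DecidableEq ι] {A B : Matrix ι ι ℂ}

lemma damped (h : IsContractivePair A B) {c : ℝ} (hc0 : 0 ≤ c) (hc1 : c ≤ 1) :
    IsContractivePair A ((c : ℂ) • B) := by
  intro v w
  have h1 := h v ((c : ℂ) • w)
  have h2 : ‖(c : ℂ)‖ ^ 2 ≤ 1 := by
    rw [Complex.norm_real, Real.norm_of_nonneg hc0]
    exact pow_le_one₀ hc0 hc1
  rw [Matrix.conjTranspose_smul, map_smul, map_smul, LinearMap.smul_apply, LinearMap.smul_apply,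
    norm_smul, norm_star, mul_pow]
  rw [map_smul, norm_smul, mul_pow] at h1
  nlinarith [mul_le_mul_of_nonneg_right h2 (sq_nonneg ‖Bᴴ.toEuclideanLin v‖),
    mul_le_mul_of_nonneg_right h2 (sq_nonneg ‖w‖)]

/-- The fixed-point equation holds without projecting onto the dissipative modes, because `A`
vanishes on the preserved ones. -/
lemma steadyState_eq (h : IsContractivePair A B) (hA : Aᴴ = -A) :
    steadyState A B = A + B * steadyState A B * Bᴴ := by
  have h1 := (h.hasSum_steadyState hA).tendsto_sum_nat
  have h2 := (tendsto_add_atTop_iff_nat 1).2 h1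
  have h3 := ((continuous_mul_gaussianStep_mul A B 1).tendsto _).comp h1
  have h4 := tendsto_nhds_unique h2 (Tendsto.congr (fun t => ?_) h3)
  · rwa [one_mul, mul_one] at h4
  · rw [Function.comp_apply, gaussianStep_sum, gaussianStep_iterate, one_mul, mul_one, mul_zero,
      zero_mul, add_zero]

lemma hasSum_steadyState_apply (h : IsContractivePair A B) (hA : Aᴴ = -A) (i j : ι) :
    HasSum (fun s : ℕ => (B ^ s * A * Bᴴ ^ s) i j) (steadyState A B i j) :=
  Pi.hasSum.1 (Pi.hasSum.1 (h.hasSum_steadyState hA) i) j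

/-- The steady state is the limit of the steady states of the damped channels. -/
lemma tendsto_steadyState_damped (h : IsContractivePair A B) (hA : Aᴴ = -A) (i j : ι) :
    Tendsto (fun c : ℝ => steadyState A ((c : ℂ) • B) i j) (𝓝[<] 1)
      (𝓝 (steadyState A B i j)) := by
  have hterm : ∀ (c : ℝ) (s : ℕ), (((c : ℂ) • B) ^ s * A * ((c : ℂ) • B)ᴴ ^ s) i j
      = (c : ℂ) ^ (2 * s) * (B ^ s * A * Bᴴ ^ s) i j := fun c s => by
    rw [Matrix.conjTranspose_smul, smul_pow, smul_pow, smul_mul_assoc, smul_mul_assoc,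
      mul_smul_comm, smul_smul, Matrix.smul_apply, smul_eq_mul, Complex.star_def,
      Complex.conj_ofReal, ← pow_add, two_mul]
  have hev : ∀ᶠ c : ℝ in 𝓝[<] 1, 0 ≤ c ∧ c ≤ 1 := by
    filter_upwards [Ioo_mem_nhdsLT (show (0 : ℝ) < 1 from one_pos)] with c hc
    exact ⟨hc.1.le, hc.2.le⟩
  rw [← (h.hasSum_steadyState_apply hA i j).tsum_eq]
  refine Tendsto.congr' (hev.mono fun c hc =>
    ((h.damped hc.1 hc.2).hasSum_steadyState_apply hA i j).tsum_eq) ?_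
  refine tendsto_tsum_of_dominated_convergence (h.summable_norm_steadyState_apply hA i j)
    (fun s => ?_) (hev.mono fun c hc s => ?_)
  · simp only [hterm]
    have : ContinuousAt (fun c : ℝ => (c : ℂ) ^ (2 * s) * (B ^ s * A * Bᴴ ^ s) i j) 1 := by
      fun_prop
    have h1 := this.tendsto.mono_left (nhdsWithin_le_nhds (s := Set.Iio 1))
    simpa using h1
  · rw [hterm, norm_mul, norm_pow, Complex.norm_real, Real.norm_of_nonneg hc.1]
    exact mul_le_of_le_one_left (norm_nonneg _) (pow_le_one₀ hc.1 hc.2)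

end IsContractivePair

section

/-! ### Rationality of the momentum-space steady state -/

open Polynomial Bivariate

lemma injOn_exp_Ico :
    Set.InjOn (fun k : ℝ => Complex.exp (Complex.I * k)) (Set.Ico 0 (2 * Real.pi)) := by
  intro x hx y hy hxy
  obtain ⟨n, hn⟩ := Complex.exp_eq_exp_iff_exists_int.1 hxy
  have h1 : (x : ℂ) = ((y + n * (2 * Real.pi) : ℝ) : ℂ) := by
    apply mul_left_cancel₀ Complex.I_ne_zero
    rw [hn]; push_cast; ring
  have h2 : x = y + n * (2 * Real.pi) := by exact_mod_cast h1
  have h3 := Real.two_pi_pos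
  have h4 : n = 0 := by
    have h5 : (n : ℝ) < 1 := by by_contra! hc; nlinarith [hx.1, hx.2, hy.1, hy.2]
    have h6 : (-1 : ℝ) < n := by by_contra! hc; nlinarith [hx.1, hx.2, hy.1, hy.2]
    have h7 : n < 1 := by exact_mod_cast h5
    have h8 : -1 < n := by exact_mod_cast h6
    omega
  simpa [h4] using h2

lemma infinite_range_exp : (Set.range fun k : ℝ => Complex.exp (Complex.I * k)).Infinite :=
  Set.infinite_of_injOn_mapsTo injOn_exp_Ico (fun k _ => ⟨k, rfl⟩)
    (Set.Ico_infinite Real.two_pi_pos)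

lemma eq_zero_of_eval_exp_eq_zero {P : ℂ[X]}
    (h : ∀ k : ℝ, P.eval (Complex.exp (Complex.I * k)) = 0) : P = 0 := by
  refine Polynomial.eq_zero_of_infinite_isRoot P (infinite_range_exp.mono ?_)
  rintro _ ⟨k, rfl⟩
  exact h k

lemma tendsto_evalEval (p : ℂ[X][Y]) (w : ℂ) :
    Tendsto (fun c : ℝ => p.evalEval w c) (𝓝[<] 1) (𝓝 ((p.eval 1).eval w)) := by
  have h1 : ∀ c : ℂ, p.evalEval w c = (p.map (evalRingHom w)).eval c := fun c => by
    rw [← coe_evalEvalRingHom, evalEvalRingHom_eq, coe_eval₂RingHom, eval_map]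
  have h2 : Continuous fun c : ℝ => (p.map (evalRingHom w)).eval (c : ℂ) :=
    (Polynomial.continuous _).comp Complex.continuous_ofReal
  simp only [h1]
  have h3 := (h2.tendsto 1).mono_left (nhdsWithin_le_nhds (s := Set.Iio 1))
  rw [Complex.ofReal_one, ← h1] at h3
  simpa [evalEval] using h3

/-- If `Z` solves `p Z = q` for polynomials in `e^{ik}` and in a damping parameter `c`, then so
does its limit for `c → 1`, for polynomials in `e^{ik}` alone: common factors `c - 1` are divided
out until the limit of `p` is not the zero polynomial. -/
lemma exists_polynomial_of_tendsto {ι : Type*} (Z : ℝ → ℝ → ι → ℂ) (Γ : ℝ → ι → ℂ)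
    (hZ : ∀ k i, Tendsto (fun c => Z k c i) (𝓝[<] 1) (𝓝 (Γ k i)))
    (n : ℕ) (p : ℂ[X][Y]) (hn : p.natDegree = n) (hp : p ≠ 0) (q : ι → ℂ[X][Y])
    (hpq : ∀ (k c : ℝ), 0 < c → c < 1 → ∀ i,
      p.evalEval (Complex.exp (Complex.I * k)) c * Z k c i
        = (q i).evalEval (Complex.exp (Complex.I * k)) c) :
    ∃ (P : ℂ[X]) (Q : ι → ℂ[X]), P ≠ 0 ∧ ∀ (k : ℝ) i,
      P.eval (Complex.exp (Complex.I * k)) * Γ k i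
        = (Q i).eval (Complex.exp (Complex.I * k)) := by
  induction n using Nat.strong_induction_on generalizing p q with
  | _ n ih =>
  have hlim : ∀ (k : ℝ) i, (p.eval 1).eval (Complex.exp (Complex.I * k)) * Γ k i
      = ((q i).eval 1).eval (Complex.exp (Complex.I * k)) := fun k i => by
    refine tendsto_nhds_unique ((tendsto_evalEval p _).mul (hZ k i))
      (Tendsto.congr' ?_ (tendsto_evalEval (q i) _))
    filter_upwards [Ioo_mem_nhdsLT (show (0 : ℝ) < 1 from one_pos)] with c hc
    exact (hpq k c hc.1 hc.2 i).symm
  by_cases h0 : p.eval 1 = 0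
  · have hq0 : ∀ i, (q i).eval 1 = 0 := fun i => eq_zero_of_eval_exp_eq_zero fun k => by
      rw [← hlim k i, h0, eval_zero, zero_mul]
    obtain ⟨p', rfl⟩ := dvd_iff_isRoot.2 h0
    choose q' hq' using fun i => dvd_iff_isRoot.2 (hq0 i)
    have hp' : p' ≠ 0 := right_ne_zero_of_mul hp
    refine ih p'.natDegree ?_ p' rfl hp' q' fun k c hc0 hc1 i => ?_
    · rw [← hn, natDegree_mul (X_sub_C_ne_zero _) hp', natDegree_X_sub_C]
      omega
    · have h1 := hpq k c hc0 hc1 i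
      rw [hq' i, evalEval_mul, evalEval_mul, mul_assoc] at h1
      refine mul_left_cancel₀ ?_ h1
      rw [evalEval_sub, evalEval_X, evalEval_C, eval_one, sub_ne_zero]
      exact_mod_cast hc1.ne
  · exact ⟨p.eval 1, fun i => (q i).eval 1, h0, hlim⟩

lemma countable_exp_eq (w : ℂ) : {k : ℝ | Complex.exp (Complex.I * k) = w}.Countable := by
  rcases Set.eq_empty_or_nonempty {k : ℝ | Complex.exp (Complex.I * k) = w} with h | ⟨k₀, hk₀⟩
  · simp [h]
  refine (Set.countable_range fun n : ℤ => k₀ + n * (2 * Real.pi)).mono fun k hk => ?_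
  obtain ⟨n, hn⟩ := Complex.exp_eq_exp_iff_exists_int.1 (Eq.trans hk (Eq.symm hk₀))
  refine ⟨n, ?_⟩
  have h1 : (k : ℂ) = ((k₀ + n * (2 * Real.pi) : ℝ) : ℂ) := by
    apply mul_left_cancel₀ Complex.I_ne_zero
    rw [hn]; push_cast; ring
  exact_mod_cast h1.symm

lemma continuous_eval_exp (P : ℂ[X]) :
    Continuous fun k : ℝ => P.eval (Complex.exp (Complex.I * k)) :=
  P.continuous.comp (by fun_prop)

/-- A family of rational functions bounded on the unit circle has no poles there: the zeros of the
common denominator on the circle cancel. -/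
lemma exists_cancel_zeros_on_circle {ι : Type*} (n : ℕ) (P : ℂ[X]) (hn : P.natDegree = n)
    (hP : P ≠ 0) (Q : ι → ℂ[X])
    (h : ∀ (k : ℝ) i, ‖(Q i).eval (Complex.exp (Complex.I * k))‖
      ≤ ‖P.eval (Complex.exp (Complex.I * k))‖) :
    ∃ (g P' : ℂ[X]) (Q' : ι → ℂ[X]), P = g * P' ∧ (∀ i, Q i = g * Q' i) ∧
      ∀ k : ℝ, P'.eval (Complex.exp (Complex.I * k)) ≠ 0 := by
  induction n using Nat.strong_induction_on generalizing P Q with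
  | _ n ih =>
  by_cases hk : ∃ k₀ : ℝ, P.eval (Complex.exp (Complex.I * k₀)) = 0
  · obtain ⟨k₀, hk₀⟩ := hk
    have hQ0 : ∀ i, (Q i).eval (Complex.exp (Complex.I * k₀)) = 0 := fun i => by
      have := h k₀ i
      rw [hk₀, norm_zero] at this
      exact norm_le_zero_iff.1 this
    obtain ⟨P₁, rfl⟩ := dvd_iff_isRoot.2 hk₀
    choose Q₁ hQ₁ using fun i => dvd_iff_isRoot.2 (hQ0 i)
    have hP₁ : P₁ ≠ 0 := right_ne_zero_of_mul hP
    obtain ⟨g, P', Q', h1, h2, h3⟩ := ih P₁.natDegree (by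
      rw [← hn, natDegree_mul (X_sub_C_ne_zero _) hP₁, natDegree_X_sub_C]
      omega) P₁ rfl hP₁ Q₁ fun k i => by
        -- the bound holds off the cancelled zero, hence everywhere by continuity
        have hd := (countable_exp_eq (Complex.exp (Complex.I * k₀))).dense_compl ℝ
        have hc : IsClosed {k : ℝ | ‖(Q₁ i).eval (Complex.exp (Complex.I * k))‖
            ≤ ‖P₁.eval (Complex.exp (Complex.I * k))‖} :=
          isClosed_le (continuous_eval_exp _).norm (continuous_eval_exp _).norm
        refine hc.closure_subset_iff.2 (fun x hx => ?_) (hd k)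
        have hx' : 0 < ‖Complex.exp (Complex.I * x) - Complex.exp (Complex.I * k₀)‖ :=
          norm_pos_iff.2 (sub_ne_zero.2 hx)
        have := h x i
        rw [hQ₁ i, eval_mul, eval_mul, norm_mul, norm_mul, eval_sub, eval_X, eval_C] at this
        exact le_of_mul_le_mul_left this hx'
    exact ⟨(X - C _) * g, P', Q', by rw [h1, mul_assoc], fun i => by rw [hQ₁ i, h2 i, mul_assoc],
      h3⟩
  · push Not at hk
    exact ⟨1, P, Q, by simp, by simp, hk⟩

/-! ### Cramer's rule for the damped steady-state equation -/

variable {m : ℕ}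

/-- The Laurent polynomial `∑ r, w ^ (ε r) f r`, made into a polynomial by the factor `w ^ D`. It is
meant for `ε = ±1` and `D` at least the range of `f`, so that no exponent is truncated. -/
noncomputable def kernelPolynomial (f : ℤ →₀ Matrix (Fin m) (Fin m) ℝ) (D ε : ℤ) (α β : Fin m) :
    ℂ[X] :=
  ∑ r ∈ f.support, C (f r α β : ℂ) * X ^ (D + ε * r).toNat

lemma eval_kernelPolynomial_of_abs_le (f : ℤ →₀ Matrix (Fin m) (Fin m) ℝ) {D : ℕ} {ε : ℤ}
    (hD : ∀ r ∈ f.support, |r| ≤ D) (hε : |ε| = 1) (α β : Fin m) (k : ℝ) :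
    (kernelPolynomial f D ε α β).eval (Complex.exp (Complex.I * k))
      = Complex.exp (Complex.I * k) ^ D
        * ∑ r ∈ f.support, Complex.exp (Complex.I * k * (ε * r)) * (f r α β : ℂ) := by
  rw [kernelPolynomial, eval_finsetSum, Finset.mul_sum]
  refine Finset.sum_congr rfl fun r hr => ?_
  have h0 : (0 : ℤ) ≤ D + ε * r := by
    have h1 := neg_abs_le (ε * r)
    rw [abs_mul, hε, one_mul] at h1
    linarith [hD r hr]
  have h1 : (((D + ε * r).toNat : ℤ) : ℂ) = ((D + ε * r : ℤ) : ℂ) := by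
    rw [Int.toNat_of_nonneg h0]
  rw [Int.cast_natCast] at h1
  rw [eval_mul, eval_C, eval_pow, eval_X, mul_comm, ← mul_assoc]
  congr 1
  rw [← Complex.exp_nat_mul, ← Complex.exp_nat_mul, ← Complex.exp_add, h1]
  congr 1
  push_cast
  ring

lemma exists_range (N : LocalGaussianChannel m) : ∃ D : ℕ,
    (∀ r ∈ N.a.support, |r| ≤ D) ∧ ∀ r ∈ N.b.support, |r| ≤ D := by
  refine ⟨∑ r ∈ N.a.support, r.natAbs + ∑ r ∈ N.b.support, r.natAbs, fun r hr => ?_,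
    fun r hr => ?_⟩
  · have := Finset.single_le_sum (f := fun r : ℤ => r.natAbs) (fun _ _ => Nat.zero_le _) hr
    rw [Int.abs_eq_natAbs]
    exact_mod_cast this.trans (Nat.le_add_right _ _)
  · have := Finset.single_le_sum (f := fun r : ℤ => r.natAbs) (fun _ _ => Nat.zero_le _) hr
    rw [Int.abs_eq_natAbs]
    exact_mod_cast this.trans (Nat.le_add_left _ _)

/-- The coefficient matrix of the linear system satisfied by the entries of the steady state of
the damped channel `(A_k, c B_k)`, as a polynomial in `w = e^{ik}` and `c`. The kernel of `B` is
real, so complex conjugation of `B_k` reverses the sign of the exponents. -/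
noncomputable def steadySystem (N : LocalGaussianChannel m) (D : ℕ) :
    Matrix (Fin m × Fin m) (Fin m × Fin m) ℂ[X][Y] :=
  Matrix.of fun p q => (if p = q then C (X ^ (2 * D)) else 0)
    - X ^ 2 * C (kernelPolynomial N.b D (-1) p.1 q.1 * kernelPolynomial N.b D 1 p.2 q.2)

lemma det_steadySystem_ne_zero (N : LocalGaussianChannel m) (D : ℕ) :
    (steadySystem N D).det ≠ 0 := by
  intro h
  have h1 := congrArg (evalEvalRingHom (1 : ℂ) (0 : ℂ)) h
  rw [RingHom.map_det, map_zero] at h1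
  -- without coupling, `c = 0`, the system is trivial
  have h2 : (evalEvalRingHom (1 : ℂ) (0 : ℂ)).mapMatrix (steadySystem N D) = 1 := by
    ext p q
    simp only [RingHom.mapMatrix_apply, Matrix.map_apply, steadySystem, Matrix.of_apply,
      coe_evalEvalRingHom, evalEval_sub, evalEval_mul, evalEval_pow, evalEval_X, Matrix.one_apply]
    split_ifs <;> simp [evalEval_C]
  rw [h2, Matrix.det_one] at h1
  exact one_ne_zero h1

lemma steadySystem_mulVec (N : LocalGaussianChannel m) {D : ℕ}
    (ha : ∀ r ∈ N.a.support, |r| ≤ D) (hb : ∀ r ∈ N.b.support, |r| ≤ D) (k c : ℝ)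
    (hc0 : 0 ≤ c) (hc1 : c ≤ 1) :
    (evalEvalRingHom (Complex.exp (Complex.I * k)) (c : ℂ)).mapMatrix (steadySystem N D)
        *ᵥ (fun p => steadyState (momentumMatrix N.a k) ((c : ℂ) • momentumMatrix N.b k) p.1 p.2)
      = fun p => (X ^ D * kernelPolynomial N.a D (-1) p.1 p.2).eval
        (Complex.exp (Complex.I * k)) := by
  have hA : ∀ α β, (kernelPolynomial N.a D (-1) α β).eval (Complex.exp (Complex.I * k))
      = Complex.exp (Complex.I * k) ^ D * momentumMatrix N.a k α β := fun α β => by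
    rw [eval_kernelPolynomial_of_abs_le N.a ha (by simp), momentumMatrix_apply]
    simp
  have hB : ∀ α β, (kernelPolynomial N.b D (-1) α β).eval (Complex.exp (Complex.I * k))
      = Complex.exp (Complex.I * k) ^ D * momentumMatrix N.b k α β := fun α β => by
    rw [eval_kernelPolynomial_of_abs_le N.b hb (by simp), momentumMatrix_apply]
    simp
  have hB' : ∀ α β, (kernelPolynomial N.b D 1 α β).eval (Complex.exp (Complex.I * k))
      = Complex.exp (Complex.I * k) ^ D * star (momentumMatrix N.b k α β) := fun α β => by
    rw [eval_kernelPolynomial_of_abs_le N.b hb (by simp), momentumMatrix_apply]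
    simp [← Complex.exp_conj]
  have hS := ((isContractivePair_momentumMatrix N k).damped hc0 hc1).steadyState_eq
    (conjTranspose_momentumMatrix N k)
  set S := steadyState (momentumMatrix N.a k) ((c : ℂ) • momentumMatrix N.b k)
  set w := Complex.exp (Complex.I * k)
  funext ⟨α, β⟩
  have hS' := congrFun (congrFun hS α) β
  rw [Matrix.conjTranspose_smul, Matrix.add_apply, Matrix.smul_mul, Matrix.smul_mul,
    Matrix.mul_smul, smul_smul, Matrix.smul_apply, smul_eq_mul, Complex.star_def,
    Complex.conj_ofReal] at hS'
  simp only [Matrix.mulVec, dotProduct, RingHom.mapMatrix_apply, Matrix.map_apply, steadySystem,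
    Matrix.of_apply, coe_evalEvalRingHom, evalEval_sub, evalEval_mul, evalEval_pow, evalEval_X,
    evalEval_C, eval_mul, eval_pow, eval_X, sub_mul, Finset.sum_sub_distrib, hA, hB, hB',
    apply_ite (evalEval w (c : ℂ)), evalEval_zero, ite_mul, zero_mul, Finset.sum_ite_eq,
    Finset.mem_univ, if_true]
  rw [hS', Matrix.mul_apply, mul_add, Finset.mul_sum, Finset.mul_sum, Fintype.sum_prod_type_right,
    add_sub_assoc, add_eq_left.2 ?_]
  · ring
  · rw [sub_eq_zero]
    refine Finset.sum_congr rfl fun δ _ => ?_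
    rw [Matrix.mul_apply, Matrix.conjTranspose_apply, Finset.sum_mul, Finset.mul_sum,
      Finset.mul_sum]
    refine Finset.sum_congr rfl fun γ _ => ?_
    ring

/-- The steady state of a momentum sector solves a nontrivial equation `P Γ = Q` whose coefficients
are polynomials in `e^{ik}`. -/
lemma exists_polynomial_steadyState (N : LocalGaussianChannel m) :
    ∃ (P : ℂ[X]) (Q : Fin m × Fin m → ℂ[X]), P ≠ 0 ∧ ∀ (k : ℝ) p,
      P.eval (Complex.exp (Complex.I * k))
          * steadyState (momentumMatrix N.a k) (momentumMatrix N.b k) p.1 p.2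
        = (Q p).eval (Complex.exp (Complex.I * k)) := by
  obtain ⟨D, ha, hb⟩ := exists_range N
  refine exists_polynomial_of_tendsto
    (fun k c p => steadyState (momentumMatrix N.a k) ((c : ℂ) • momentumMatrix N.b k) p.1 p.2)
    (fun k p => steadyState (momentumMatrix N.a k) (momentumMatrix N.b k) p.1 p.2)
    (fun k p => (isContractivePair_momentumMatrix N k).tendsto_steadyState_damped
      (conjTranspose_momentumMatrix N k) p.1 p.2) _ _ rfl (det_steadySystem_ne_zero N D)
    ((steadySystem N D).adjugate *ᵥ fun p => C (X ^ D * kernelPolynomial N.a D (-1) p.1 p.2))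
    fun k c hc0 hc1 p => ?_
  set φ := evalEvalRingHom (Complex.exp (Complex.I * k)) (c : ℂ) with hφ
  have h1 := congrArg ((φ.mapMatrix (steadySystem N D)).adjugate *ᵥ ·)
    (steadySystem_mulVec N ha hb k c hc0.le hc1.le)
  simp only [Matrix.mulVec_mulVec, ← hφ, Matrix.adjugate_mul, Matrix.smul_mulVec,
    Matrix.one_mulVec] at h1
  have h2 := congrFun h1 p
  rw [Pi.smul_apply, smul_eq_mul, ← RingHom.map_det, ← RingHom.map_adjugate] at h2
  rw [← coe_evalEvalRingHom, ← hφ]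
  refine h2.trans ?_
  simp only [Matrix.mulVec, dotProduct, map_sum, map_mul, RingHom.mapMatrix_apply,
    Matrix.map_apply]
  refine Finset.sum_congr rfl fun q _ => ?_
  simp [hφ]

/-- Up to finitely many points of the unit circle the steady state is a rational function of
`e^{ik}` without poles on the circle: it is bounded, being a limit of correlation matrices. -/
lemma exists_rational_steadyState (N : LocalGaussianChannel m) :
    ∃ (g P : ℂ[X]) (Q : Fin m × Fin m → ℂ[X]), g ≠ 0 ∧
      (∀ k : ℝ, P.eval (Complex.exp (Complex.I * k)) ≠ 0) ∧
      ∀ (k : ℝ) p, g.eval (Complex.exp (Complex.I * k)) ≠ 0 →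
        steadyState (momentumMatrix N.a k) (momentumMatrix N.b k) p.1 p.2
          = (Q p).eval (Complex.exp (Complex.I * k)) / P.eval (Complex.exp (Complex.I * k)) := by
  obtain ⟨P, Q, hP, hPQ⟩ := exists_polynomial_steadyState N
  obtain ⟨g, P', Q', rfl, hQ, hP'⟩ := exists_cancel_zeros_on_circle _ P rfl hP Q fun k p => by
    rw [← hPQ, norm_mul]
    exact mul_le_of_le_one_right (norm_nonneg _)
      ((isContractivePair_momentumMatrix N k).norm_steadyState_apply_le
        (conjTranspose_momentumMatrix N k) _ _)
  refine ⟨g, P', Q', left_ne_zero_of_mul hP, hP', fun k p hg => ?_⟩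
  rw [eq_div_iff (hP' k), mul_comm]
  have h := hPQ k p
  rw [hQ, eval_mul, eval_mul, mul_assoc] at h
  exact mul_left_cancel₀ hg h

/-! ### Rational functions without poles on the unit circle -/

lemma finite_eval_exp_eq_zero {g : ℂ[X]} (hg : g ≠ 0) :
    {k : ℝ | k ∈ Set.Ico 0 (2 * Real.pi) ∧ g.eval (Complex.exp (Complex.I * k)) = 0}.Finite :=
  Set.Finite.of_injOn (t := {z | g.IsRoot z}) (fun _ hk => hk.2)
    (injOn_exp_Ico.mono fun _ hk => hk.1) (finite_setOfPred_isRoot hg)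

/-- A polynomial without zeros on the unit circle has none in an annulus around it. -/
lemma exists_annulus {P : ℂ[X]} (hP : ∀ k : ℝ, P.eval (Complex.exp (Complex.I * k)) ≠ 0) :
    ∃ δ : ℝ, 0 < δ ∧ ∀ z : ℂ, z ≠ 0 → |Real.log ‖z‖| < δ → P.eval z ≠ 0 := by
  have hP0 : P ≠ 0 := by
    rintro rfl
    exact hP 0 eval_zero
  have hfin := ((finite_setOfPred_isRoot hP0).inter_of_left {z | z ≠ 0}).image
    fun z => Real.log ‖z‖
  have h0 : (0 : ℝ) ∉ (fun z : ℂ => Real.log ‖z‖) '' ({z | P.IsRoot z} ∩ {z | z ≠ 0}) := by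
    rintro ⟨z, ⟨hz1, hz2⟩, hz3⟩
    have hz4 : ‖z‖ = 1 := Real.eq_one_of_pos_of_log_eq_zero (norm_pos_iff.2 hz2) hz3
    apply hP z.arg
    have h := Complex.norm_mul_exp_arg_mul_I z
    rw [hz4, Complex.ofReal_one, one_mul, mul_comm] at h
    rw [h]
    exact hz1
  obtain ⟨δ, hδ, hball⟩ := Metric.mem_nhds_iff.1 (hfin.isClosed.isOpen_compl.mem_nhds h0)
  refine ⟨δ, hδ, fun z hz hlog hroot => ?_⟩
  exact hball (by simpa [Real.dist_eq] using hlog) ⟨z, ⟨hroot, hz⟩, rfl⟩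

lemma log_norm_exp_I_mul (z : ℂ) : Real.log ‖Complex.exp (Complex.I * z)‖ = -z.im := by
  rw [Complex.norm_exp, Real.log_exp]
  simp

/-- The Laurent coefficient of `z ^ (-n)` of a function on the unit circle; in this sign convention
the coefficients of the momentum-space steady state are its real-space correlations. -/
noncomputable def laurentCoeff (f : ℂ → ℂ) (n : ℤ) : ℂ :=
  (2 * Real.pi * Complex.I : ℂ)⁻¹ • ∮ z in C(0, 1), z ^ (n - 1) * f z

lemma laurentCoeff_eq_integral (f : ℂ → ℂ) (n : ℤ) :
    laurentCoeff f n = (2 * Real.pi : ℂ)⁻¹ * ∫ θ in (0 : ℝ)..2 * Real.pi,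
      Complex.exp (Complex.I * θ * n) * f (Complex.exp (Complex.I * θ)) := by
  have h : ∀ θ : ℝ, deriv (circleMap 0 1) θ • (circleMap 0 1 θ ^ (n - 1) * f (circleMap 0 1 θ))
      = Complex.I * (Complex.exp (Complex.I * θ * n) * f (Complex.exp (Complex.I * θ))) := by
    intro θ
    rw [deriv_circleMap, smul_eq_mul]
    simp only [circleMap, Complex.ofReal_one, one_mul, zero_add]
    rw [mul_comm (θ : ℂ) Complex.I, zpow_sub_one₀ (Complex.exp_ne_zero _), ← Complex.exp_int_mul,
      mul_comm (n : ℂ)]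
    field_simp
  rw [laurentCoeff, circleIntegral]
  simp only [h]
  rw [intervalIntegral.integral_const_mul, smul_eq_mul, mul_inv, mul_assoc,
    inv_mul_cancel_left₀ Complex.I_ne_zero]

lemma laurentCoeff_eq_circleIntegral {f : ℂ → ℂ} {δ : ℝ}
    (hf : ∀ z : ℂ, z ≠ 0 → |Real.log ‖z‖| < δ → DifferentiableAt ℂ f z) (n : ℤ) {η : ℝ}
    (hη : |η| < δ) : laurentCoeff f n
      = (2 * Real.pi * Complex.I : ℂ)⁻¹ • ∮ z in C(0, Real.exp η), z ^ (n - 1) * f z := by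
  have key : ∀ a b : ℝ, |a| < δ → |b| < δ → a ≤ b →
      (∮ z in C(0, Real.exp b), z ^ (n - 1) * f z)
        = ∮ z in C(0, Real.exp a), z ^ (n - 1) * f z := by
    intro a b ha hb hab
    have hd : ∀ z : ℂ, Real.exp a ≤ ‖z‖ → ‖z‖ ≤ Real.exp b →
        DifferentiableAt ℂ (fun z => z ^ (n - 1) * f z) z := by
      intro z h1 h2
      have hz : 0 < ‖z‖ := (Real.exp_pos a).trans_le h1
      have hz0 : z ≠ 0 := norm_pos_iff.1 hz
      refine (differentiableAt_zpow.2 (Or.inl hz0)).mul (hf z hz0 ?_)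
      have h3 := (Real.le_log_iff_exp_le hz).2 h1
      have h4 := (Real.log_le_iff_le_exp hz).2 h2
      rw [abs_lt] at ha hb ⊢
      constructor <;> linarith
    refine Complex.circleIntegral_eq_of_differentiable_on_annulus_off_countable
      (Real.exp_pos a) (Real.exp_le_exp.2 hab) Set.countable_empty (fun z hz => ?_) fun z hz => ?_
    · refine (hd z ?_ ?_).continuousAt.continuousWithinAt
      · simpa using hz.2
      · simpa using hz.1
    · refine hd z ?_ ?_
      · exact le_of_lt (by simpa using hz.1.2)
      · exact le_of_lt (by simpa using hz.1.1)
  have h0 : |(0 : ℝ)| < δ := by simpa using (abs_nonneg η).trans_lt hη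
  rw [laurentCoeff, ← Real.exp_zero]
  rcases le_total 0 η with h | h
  · rw [key 0 η h0 hη h]
  · rw [key η 0 hη h0 h]

lemma exists_norm_laurentCoeff_le_zpow {f : ℂ → ℂ} {δ : ℝ}
    (hf : ∀ z : ℂ, z ≠ 0 → |Real.log ‖z‖| < δ → DifferentiableAt ℂ f z) {η : ℝ}
    (hη : |η| < δ) : ∃ K : ℝ, 0 ≤ K ∧ ∀ n : ℤ, ‖laurentCoeff f n‖ ≤ K * Real.exp (η * n) := by
  have hsphere : ∀ z ∈ Metric.sphere (0 : ℂ) (Real.exp η), ‖z‖ = Real.exp η := by simp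
  obtain ⟨K, hK⟩ := (isCompact_sphere (0 : ℂ) (Real.exp η)).exists_bound_of_continuousOn
    (f := f) fun z hz => by
      have h1 := hsphere z hz
      refine (hf z (norm_pos_iff.1 (h1 ▸ Real.exp_pos η)) ?_).continuousAt.continuousWithinAt
      rwa [h1, Real.log_exp]
  refine ⟨|K|, abs_nonneg K, fun n => ?_⟩
  rw [laurentCoeff_eq_circleIntegral hf n hη]
  refine (circleIntegral.norm_two_pi_i_inv_smul_integral_le_of_norm_le_const
    (C := Real.exp (η * (n - 1)) * |K|) (Real.exp_pos η).le fun z hz => ?_).trans (le_of_eq ?_)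
  · rw [norm_mul, norm_zpow, hsphere z hz, ← Real.rpow_intCast, ← Real.exp_mul]
    push_cast
    gcongr
    exact (hK z hz).trans (le_abs_self K)
  · rw [← mul_assoc, ← Real.exp_add, mul_comm]
    congr 2
    ring

/-- Laurent coefficients of a function holomorphic on an annulus around the unit circle decay
exponentially: the circle of integration can be moved inwards or outwards. -/
lemma exists_norm_laurentCoeff_le {f : ℂ → ℂ} {δ : ℝ}
    (hf : ∀ z : ℂ, z ≠ 0 → |Real.log ‖z‖| < δ → DifferentiableAt ℂ f z) {η : ℝ}
    (hη0 : 0 ≤ η) (hη : η < δ) :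
    ∃ K : ℝ, 0 ≤ K ∧ ∀ n : ℤ, ‖laurentCoeff f n‖ ≤ K * Real.exp (-(η * |(n : ℝ)|)) := by
  obtain ⟨K₁, hK₁, h₁⟩ := exists_norm_laurentCoeff_le_zpow hf (η := η) (by rwa [abs_of_nonneg hη0])
  obtain ⟨K₂, hK₂, h₂⟩ := exists_norm_laurentCoeff_le_zpow hf (η := -η)
    (by rwa [abs_neg, abs_of_nonneg hη0])
  refine ⟨K₁ + K₂, by positivity, fun n => ?_⟩
  rcases le_total 0 (n : ℝ) with h | h
  · refine (h₂ n).trans ?_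
    rw [abs_of_nonneg h, ← neg_mul]
    gcongr
    linarith
  · refine (h₁ n).trans ?_
    rw [abs_of_nonpos h, mul_neg, neg_neg]
    gcongr
    linarith

/-! ### Averages over the momenta of a ring -/

/-- Convergence of Riemann sums. -/
lemma tendsto_average_unitInterval {φ : ℝ → ℂ} (hφ : Continuous φ) :
    Tendsto (fun n : ℕ => (n : ℂ)⁻¹ * ∑ j ∈ Finset.range n, φ (j / n)) atTop
      (𝓝 (∫ t in (0 : ℝ)..1, φ t)) := by
  have huc := isCompact_Icc (a := (0 : ℝ)) (b := 1) |>.uniformContinuousOn_of_continuous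
    hφ.continuousOn
  rw [Metric.tendsto_atTop]
  intro ε hε
  obtain ⟨δ, hδ, hφδ⟩ := Metric.uniformContinuousOn_iff.1 huc (ε / 2) (half_pos hε)
  obtain ⟨n₀, hn₀⟩ := exists_nat_gt (1 / δ)
  refine ⟨n₀ + 1, fun n hn => ?_⟩
  have hn0 : (0 : ℝ) < n := by exact_mod_cast Nat.lt_of_lt_of_le n₀.succ_pos hn
  have hnδ : 1 / (n : ℝ) < δ := by
    rw [div_lt_comm₀ hn0 hδ]
    exact hn₀.trans (by exact_mod_cast hn)
  have hint : ∀ a b : ℝ, IntervalIntegrable φ MeasureTheory.volume a b :=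
    fun a b => hφ.intervalIntegrable a b
  have hsum := intervalIntegral.sum_integral_adjacent_intervals (n := n)
    (a := fun j : ℕ => (j : ℝ) / n) fun k _ => hint _ _
  rw [Nat.cast_zero, zero_div, div_self hn0.ne'] at hsum
  have hconst : ∀ j : ℕ, ∫ _ in (j : ℝ) / n..((j + 1 : ℕ) : ℝ) / n, φ (j / n)
      = (n : ℂ)⁻¹ * φ (j / n) := fun j => by
    rw [intervalIntegral.integral_const, ← sub_div, Complex.real_smul]
    push_cast
    ring
  rw [dist_eq_norm, ← hsum, Finset.mul_sum, ← Finset.sum_sub_distrib]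
  have hterm : ∀ j ∈ Finset.range n,
      ‖(n : ℂ)⁻¹ * φ (j / n) - ∫ t in (j : ℝ) / n..((j + 1 : ℕ) : ℝ) / n, φ t‖
        ≤ ε / 2 * (1 / n) := by
    intro j hj
    have hj1 : (j : ℝ) + 1 ≤ n := by exact_mod_cast Finset.mem_range.1 hj
    have hle : (j : ℝ) / n ≤ ((j + 1 : ℕ) : ℝ) / n := by
      push_cast
      gcongr
      linarith
    have hlen : ((j + 1 : ℕ) : ℝ) / n - (j : ℝ) / n = 1 / n := by
      push_cast
      ring
    rw [← hconst j, ← intervalIntegral.integral_sub intervalIntegrable_const (hint _ _)]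
    refine (intervalIntegral.norm_integral_le_of_norm_le_const (C := ε / 2)
      fun t ht => ?_).trans (le_of_eq ?_)
    · rw [Set.uIoc_of_le hle] at ht
      have hj0 : (0 : ℝ) ≤ j / n := by positivity
      have hj2 : ((j + 1 : ℕ) : ℝ) / n ≤ 1 := by
        rw [div_le_one hn0]
        exact_mod_cast Finset.mem_range.1 hj
      rw [← dist_eq_norm]
      refine (hφδ _ ⟨hj0, by linarith⟩ _ ⟨by linarith [ht.1], by linarith [ht.2]⟩ ?_).le
      rw [dist_comm, Real.dist_eq, abs_of_nonneg (by linarith [ht.1])]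
      linarith [ht.2]
    · rw [hlen, abs_of_nonneg (by positivity)]
  calc _ ≤ ∑ j ∈ Finset.range n, ε / 2 * (1 / n) := norm_sum_le_of_le _ hterm
    _ = ε / 2 := by
      rw [Finset.sum_const, Finset.card_range, nsmul_eq_mul]
      field_simp
    _ < ε := half_lt_self hε

lemma sum_ringMomentum {E : Type*} [AddCommMonoid E] (φ : ℝ → E) (L : ℕ+) :
    ∑ j : ZMod L, φ (ringMomentum L j)
      = ∑ j ∈ Finset.range L, φ (2 * Real.pi * (j / (L : ℕ))) :=
  Finset.sum_nbij' (fun j => j.val) (fun j => (j : ZMod L))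
    (fun _ _ => Finset.mem_range.2 (ZMod.val_lt _)) (fun _ _ => Finset.mem_univ _)
    (fun _ _ => ZMod.natCast_zmod_val _)
    (fun _ hj => ZMod.val_cast_of_lt (Finset.mem_range.1 hj)) fun _ _ => rfl

lemma ringMomentum_mem_Ico (L : ℕ+) (j : ZMod L) :
    ringMomentum L j ∈ Set.Ico 0 (2 * Real.pi) := by
  have hL : (0 : ℝ) < (L : ℕ) := by exact_mod_cast L.pos
  have hj : (j.val : ℝ) < (L : ℕ) := by exact_mod_cast ZMod.val_lt j
  constructor
  · unfold ringMomentum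
    positivity
  · exact mul_lt_of_lt_one_right Real.two_pi_pos ((div_lt_one hL).2 hj)

lemma ringMomentum_injective (L : ℕ+) : Function.Injective (ringMomentum L) := by
  intro i j hij
  have hL : ((L : ℕ) : ℝ) ≠ 0 := by exact_mod_cast L.ne_zero
  have h1 := (div_left_inj' hL).1 (mul_left_cancel₀ Real.two_pi_pos.ne' hij)
  exact ZMod.val_injective _ (by exact_mod_cast h1)

lemma tendsto_pnat_coe_atTop : Tendsto (fun L : ℕ+ => (L : ℕ)) atTop atTop :=
  tendsto_atTop.2 fun b => (eventually_ge_atTop b.succPNat).mono fun _ hL =>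
    (Nat.le_succ b).trans (PNat.coe_le_coe _ _ |>.2 hL)

lemma tendsto_average_ringMomentum {φ : ℝ → ℂ} (hφ : Continuous φ) :
    Tendsto (fun L : ℕ+ => (L : ℂ)⁻¹ * ∑ j : ZMod L, φ (ringMomentum L j)) atTop
      (𝓝 ((2 * Real.pi : ℂ)⁻¹ * ∫ θ in (0 : ℝ)..2 * Real.pi, φ θ)) := by
  have h1 := tendsto_average_unitInterval (φ := fun t => φ (2 * Real.pi * t)) (by fun_prop)
  rw [intervalIntegral.integral_comp_mul_left φ Real.two_pi_pos.ne', mul_zero, mul_one,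
    Complex.real_smul] at h1
  push_cast at h1
  refine Tendsto.congr (fun L => ?_) (h1.comp tendsto_pnat_coe_atTop)
  rw [sum_ringMomentum, Function.comp_apply]

/-- Finitely many exceptional momenta do not contribute to the thermodynamic limit. -/
lemma tendsto_average_ringMomentum_of_finite {γ φ : ℝ → ℂ} (hφ : Continuous φ)
    (hfin : {k | k ∈ Set.Ico 0 (2 * Real.pi) ∧ γ k ≠ φ k}.Finite) :
    Tendsto (fun L : ℕ+ => (L : ℂ)⁻¹ * ∑ j : ZMod L, γ (ringMomentum L j)) atTop
      (𝓝 ((2 * Real.pi : ℂ)⁻¹ * ∫ θ in (0 : ℝ)..2 * Real.pi, φ θ)) := by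
  classical
  set K := ∑ k ∈ hfin.toFinset, ‖γ k - φ k‖
  have hbound : ∀ L : ℕ+, ∑ j : ZMod L, ‖γ (ringMomentum L j) - φ (ringMomentum L j)‖ ≤ K := by
    intro L
    rw [← Finset.sum_image (s := Finset.univ) (f := fun k => ‖γ k - φ k‖)
      fun i _ j _ hij => ringMomentum_injective L hij]
    rw [← Finset.sum_filter_ne_zero]
    refine Finset.sum_le_sum_of_subset_of_nonneg (fun k hk => ?_) fun _ _ _ => norm_nonneg _
    obtain ⟨hk, hne⟩ := Finset.mem_filter.1 hk
    obtain ⟨j, -, rfl⟩ := Finset.mem_image.1 hk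
    rw [Set.Finite.mem_toFinset]
    exact ⟨ringMomentum_mem_Ico L j, fun h => hne (by rw [h, sub_self, norm_zero])⟩
  have hzero : Tendsto (fun L : ℕ+ => (L : ℂ)⁻¹
      * ∑ j : ZMod L, (γ (ringMomentum L j) - φ (ringMomentum L j))) atTop (𝓝 0) := by
    have h1 : Tendsto (fun L : ℕ+ => ((L : ℕ) : ℝ)⁻¹ * K) atTop (𝓝 0) := by
      simpa using (tendsto_inv_atTop_nhds_zero_nat (𝕜 := ℝ).comp
        tendsto_pnat_coe_atTop).mul_const K
    refine squeeze_zero_norm (fun L => ?_) h1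
    rw [norm_mul, norm_inv, Complex.norm_natCast]
    gcongr
    exact (norm_sum_le _ _).trans (hbound L)
  have h := hzero.add (tendsto_average_ringMomentum hφ)
  rw [zero_add] at h
  refine h.congr fun L => ?_
  rw [← mul_add, ← Finset.sum_add_distrib]
  simp

end

/-! ### Analyticity and exponential decay of the steady state -/

theorem mainTheorem4 {m : ℕ} (N : LocalGaussianChannel m) :
    ∃ (Γk : ℝ → Matrix (Fin m) (Fin m) ℂ)
      (Γ : ∀ L : ℕ+, Matrix (ZMod L × Fin m) (ZMod L × Fin m) ℂ)
      (G : ℤ → Matrix (Fin m) (Fin m) ℂ),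
      -- the dissipative steady state in every momentum sector
      (∀ k : ℝ,
        IsDissipativeSteadyState (momentumMatrix N.a k) (momentumMatrix N.b k) (Γk k)) ∧
      AnalyticUpToRemovable Γk ∧
      -- the dissipative steady state on the ring of `L` unit cells, in real space
      (∀ L : ℕ+,
        IsDissipativeSteadyState ((ringMatrix N.a L).map Complex.ofReal)
          ((ringMatrix N.b L).map Complex.ofReal) (Γ L)) ∧
      -- the thermodynamic limit of its correlation functions
      (∀ (x y : ℤ) (α β : Fin m),
        Tendsto (fun L : ℕ+ => Γ L ((x : ZMod L), α) ((y : ZMod L), β)) atTop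
          (𝓝 (G (x - y) α β))) ∧
      -- exponential decay in space
      ∃ C ξ : ℝ, 0 < C ∧ 0 < ξ ∧
        ∀ (x : ℤ) (α β : Fin m), ‖G x α β‖ ≤ C * Real.exp (-(|x| : ℝ) / ξ) := by
  obtain ⟨g, P, Q, hg, hP, hΓ⟩ := exists_rational_steadyState N
  obtain ⟨δ, hδ, hann⟩ := exists_annulus hP
  set f : Fin m × Fin m → ℂ → ℂ := fun p z => (Q p).eval z / P.eval z
  have hf : ∀ p, ∀ z : ℂ, z ≠ 0 → |Real.log ‖z‖| < δ → DifferentiableAt ℂ (f p) z :=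
    fun p z hz hlog => (Q p).differentiableAt.div P.differentiableAt (hann z hz hlog)
  have hfin : {k : ℝ | k ∈ Set.Ico 0 (2 * Real.pi) ∧
      g.eval (Complex.exp (Complex.I * k)) = 0}.Finite := finite_eval_exp_eq_zero hg
  choose K hK0 hK using fun p => exists_norm_laurentCoeff_le (hf p) (half_pos hδ).le
    (half_lt_self hδ)
  refine ⟨fun k => steadyState (momentumMatrix N.a k) (momentumMatrix N.b k),
    fun L => steadyState ((ringMatrix N.a L).map Complex.ofReal)
      ((ringMatrix N.b L).map Complex.ofReal),
    fun n => Matrix.of fun α β => laurentCoeff (f (α, β)) n,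
    fun k => (isContractivePair_momentumMatrix N k).isDissipativeSteadyState
      (conjTranspose_momentumMatrix N k), ⟨fun k => ?_, δ, hδ,
    fun z => Matrix.of fun α β => f (α, β) (Complex.exp (Complex.I * z)),
    fun α β z hz => ?_, fun z => ?_, ?_⟩,
    fun L => (N.isChannel L).isContractivePair.isDissipativeSteadyState
      (N.isChannel L).conjTranspose_map, fun x y α β => ?_,
    ∑ p, K p + 1, (δ / 2)⁻¹, ?_, by positivity, fun x α β => ?_⟩
  · simp only [momentumMatrix_add_two_pi]
  · refine DifferentiableAt.differentiableWithinAt ?_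
    have hd : DifferentiableAt ℂ (fun z => Complex.exp (Complex.I * z)) z := by fun_prop
    refine (hf (α, β) (Complex.exp (Complex.I * z)) (Complex.exp_ne_zero _) ?_).comp z hd
    rw [log_norm_exp_I_mul, abs_neg]
    exact hz
  · have h : Complex.exp (Complex.I * (z + 2 * Real.pi)) = Complex.exp (Complex.I * z) :=
      Complex.exp_eq_exp_iff_exists_int.2 ⟨1, by push_cast; ring⟩
    simp only [h]
  · refine hfin.subset fun k hk => ⟨hk.1, ?_⟩
    by_contra hne
    exact hk.2 (Matrix.ext fun α β => hΓ k (α, β) hne)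
  · simp only [steadyState_ringMatrix_apply, ← Int.cast_sub, stdAddChar_mul_intCast,
      Matrix.of_apply, laurentCoeff_eq_integral]
    refine tendsto_average_ringMomentum_of_finite
      (γ := fun k => Complex.exp (Complex.I * k * ((x - y : ℤ) : ℂ))
        * steadyState (momentumMatrix N.a k) (momentumMatrix N.b k) α β) ?_ ?_
    · exact Continuous.mul (by fun_prop)
        ((continuous_eval_exp (Q (α, β))).div (continuous_eval_exp P) hP)
    · refine hfin.subset fun k hk => ⟨hk.1, ?_⟩
      by_contra hne
      exact hk.2 (congrArg (_ * ·) (hΓ k (α, β) hne))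
  · have := Finset.sum_nonneg fun p (_ : p ∈ Finset.univ) => hK0 p
    linarith
  · refine (hK (α, β) x).trans ?_
    rw [div_inv_eq_mul, neg_mul, mul_comm |(x : ℝ)|]
    gcongr
    have := Finset.single_le_sum (fun p _ => hK0 p) (Finset.mem_univ (α, β))
    linarith
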